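/- Fix an integer $d\ge 1$ and a function $\sigma=(\sigma(i,j;k,l))_{i,j,k,l=1}^d$ with complex values. For each $N\ge 1$ let $n=dN$ and let $$X_N=\sum_{i,j=1}^d E_{ij}\otimes A^{(i,j)}$$ be a random $d\times d$ block matrix, where the $E_{ij}$ are the $d\times d$ matrix units and the blocks $A^{(i,j)}=(a^{(i,j)}_{rp})_{r,p=1}^N$ are complex $N\times N$ random matrices. Assume that the collection of all entries $a^{(i,j)}_{rp}$ is a (jointly) Gaussian family of complex random variables, possibly degenerate, with $E[a^{(i,j)}_{rp}]=0$, $$a^{(i,j)}_{rp}=\overline{a^{(j,i)}_{pr}}\quad\text{almost surely},\qquad E\bigl[a^{(i,j)}_{rp}\,a^{(k,l)}_{qs}\bigr]=\frac1n\,\delta_{rs}\,\delta_{pq}\,\sigma(i,j;k,l)$$ for all $i,j,k,l\in\{1,\dots,d\}$ and $r,p,q,s\in\{1,\dots,N\}$. (In particular $X_N$ is selfadjoint; blocks may repeat or appear as adjoints.) Define the covariance mapping $\eta:M_d(\mathbb C)\to M_d(\mathbb C)$ and the normalized trace $\mathrm{tr}_d$ by $$[\eta(D)]_{ij}=\frac1d\sum_{k,l=1}^d\sigma(i,k;l,j)\,D_{kl},\qquad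 \mathrm{tr}_d(D)=\frac1d\sum_{i=1}^d D_{ii}.$$ Then, as $N\to\infty$, the averaged eigenvalue distributions $B\mapsto E\bigl[\frac1n\#\{i:\lambda_i(X_N)\in B\}\bigr]$ (eigenvalues counted with multiplicity) converge weakly to a probability measure $\mu$ on $\mathbb R$. Its Cauchy transform $G(z)=\int_{\mathbb R}\frac{1}{z-t}\,d\mu(t)$ satisfies $$G(z)=\mathrm{tr}_d(\mathcal G(z)),\qquad \operatorname{Im} z>0,$$ where $\mathcal G$ is an $M_d(\mathbb C)$-valued analytic function on the upper half plane which satisfies $$\lim_{|z|\to\infty,\ \operatorname{Im}z>0} z\,\mathcal G(z)=I_d$$ and $$z\,\mathcal G(z)=I_d+\eta(\mathcal G(z))\cdot\mathcal G(z)\qquad\text{for all } z \text{ with } \operatorname{Im}z>0,$$ and $\mathcal G$ is the only analytic function on the upper half plane with these two properties. -/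

import Mathlib

open MeasureTheory ProbabilityTheory Filter Topology
open scoped BoundedContinuousFunction ComplexConjugate

noncomputable section

namespace BlockMatrix

/-- The open upper half plane `ℂ⁺`. -/
def upperHalf : Set ℂ := {z | 0 < z.im}

/-- The block matrix `∑ i j, E i j ⊗ A i j`: its `(i, j)` block is the `N × N` matrix `A i j`. -/
def blockMatrix {d N : ℕ} (A : Fin d → Fin d → Matrix (Fin N) (Fin N) ℂ) :
    Matrix (Fin d × Fin N) (Fin d × Fin N) ℂ :=
  Matrix.of fun x y => A x.1 y.1 x.2 y.2

/-- The definition of `blockMatrix` by entries agrees with the Kronecker-product formula. -/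
theorem blockMatrix_eq_sum_kronecker {d N : ℕ}
    (A : Fin d → Fin d → Matrix (Fin N) (Fin N) ℂ) :
    blockMatrix A =
      ∑ i, ∑ j, Matrix.kronecker (Matrix.single i j (1 : ℂ)) (A i j) := by
  ext ⟨i, r⟩ ⟨j, p⟩
  simp [blockMatrix, Matrix.sum_apply, Matrix.kronecker, Matrix.kroneckerMap_apply,
    Matrix.single_apply, ite_and, ite_mul]

/-- The random entries `a i j r p` (entry `(r, p)` of the block `(i, j)`) form a jointly Gaussian
centred family, which makes the block matrix selfadjoint, and has the covariance
`E[a i j r p * a k l q s] = δ_{rs} δ_{pq} σ(i,j;k,l) / n`, where `n = d N`. Joint Gaussianity of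
complex variables means that all real and imaginary parts are jointly Gaussian (possibly
degenerate). -/
structure IsGaussianBlockFamily {d N : ℕ} {Ω : Type*} [MeasurableSpace Ω] (P : Measure Ω)
    (σ : Fin d → Fin d → Fin d → Fin d → ℂ)
    (a : Fin d → Fin d → Fin N → Fin N → Ω → ℂ) : Prop where
  gaussian : HasGaussianLaw
    (fun ω => fun x : Fin d × Fin d × Fin N × Fin N => a x.1 x.2.1 x.2.2.1 x.2.2.2 ω) P
  selfadjoint : ∀ᵐ ω ∂P, ∀ i j r p, a i j r p ω = conj (a j i p r ω)
  mean_zero : ∀ i j r p, ∫ ω, a i j r p ω ∂P = 0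
  covariance : ∀ i j k l r p q s,
    ∫ ω, a i j r p ω * a k l q s ω ∂P =
      if r = s ∧ p = q then σ i j k l / ((d * N : ℕ) : ℂ) else 0

open Classical in
/-- The empirical eigenvalue distribution of a selfadjoint matrix: mass `1 / n` at each of the `n`
eigenvalues, counted with multiplicity (and, by convention, the zero measure if the matrix is not
selfadjoint). -/
def eigenvalueDistribution {ι : Type*} [Fintype ι] (X : Matrix ι ι ℂ) : Measure ℝ :=
  if h : X.IsHermitian then
    (Fintype.card ι : ENNReal)⁻¹ • ∑ i, Measure.dirac (h.eigenvalues i)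
  else 0

/-- The averaged eigenvalue distribution of a random matrix `X`: the expectation
`B ↦ E[(1 / n) #{i | λ_i(X) ∈ B}]` of the empirical eigenvalue distribution. -/
def averagedEigenvalueDistribution {ι Ω : Type*} [Fintype ι] [MeasurableSpace Ω]
    (P : Measure Ω) (X : Ω → Matrix ι ι ℂ) : Measure ℝ :=
  P.bind fun ω => eigenvalueDistribution (X ω)

/-- The Cauchy transform of a measure on the real line. -/
def cauchyTransform (μ : Measure ℝ) (z : ℂ) : ℂ := ∫ t : ℝ, 1 / (z - (t : ℂ)) ∂μ

/-- The covariance mapping `[η(D)]_{ij} = (1 / d) ∑_{k,l} σ(i,k;l,j) d_{kl}`. -/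
def covMap {d : ℕ} (σ : Fin d → Fin d → Fin d → Fin d → ℂ) (D : Matrix (Fin d) (Fin d) ℂ) :
    Matrix (Fin d) (Fin d) ℂ :=
  Matrix.of fun i j => (1 / (d : ℂ)) * ∑ k, ∑ l, σ i k l j * D k l

/-- The normalized trace `tr_d`. -/
def normTrace {d : ℕ} (D : Matrix (Fin d) (Fin d) ℂ) : ℂ := (1 / (d : ℂ)) * D.trace

/-- `G` is an analytic matrix-valued function on the upper half plane with `z G(z) → I_d` as
`|z| → ∞` there, which solves `z G(z) = I_d + η(G(z)) G(z)`. -/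
structure IsOperatorCauchySolution {d : ℕ} (σ : Fin d → Fin d → Fin d → Fin d → ℂ)
    (G : ℂ → Matrix (Fin d) (Fin d) ℂ) : Prop where
  analytic : ∀ i j, AnalyticOnNhd ℂ (fun z => G z i j) upperHalf
  tendsto : Tendsto (fun z => z • G z) (Bornology.cobounded ℂ ⊓ 𝓟 upperHalf) (𝓝 1)
  equation : ∀ z ∈ upperHalf, z • G z = 1 + covMap σ (G z) * G z

end BlockMatrix

end

/-!
The proof follows the expected resolvent of the block matrix `X = X_N` as `N → ∞`. Let
`R(z) = (z - X)⁻¹` and let `G_N(z)`, a `d × d` matrix, be the expectation of the partial trace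
`(id ⊗ tr_N) R(z)` (`blockTrace`). The normalized trace of `G_N(z)` is the Cauchy transform of the
averaged eigenvalue distribution (`cauchyTransform_averagedEigenvalueDistribution_eq`).

The equation for the limit comes from Gaussian integration by parts. Both integration by parts
(`integral_mul_eq_integral_deriv`) and a Poincaré inequality (`integral_norm_sub_sq_le`) are derived
from the invariance of two independent copies of a centred Gaussian vector under the rotations
`(x, y) ↦ (cos θ x + sin θ y, -sin θ x + cos θ y)`; this needs no densities, so degenerate families
are allowed. Applied to `z R = 1 + X R`, integration by parts yields the Schwinger-Dyson equation
`z E[g] = 1 + E[η(g) g]` for the random partial trace `g = (id ⊗ tr_N) R(z)`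
(`IsGaussianBlockLaw.mul_blockTrace_meanResolvent`); the shape `δ_{rs} δ_{pq}` of the covariance is
what makes partial traces appear on the right. The entries of `X` have covariance of order `1 / N`
as a quadratic form, and the gradient of `g` has norm of order `N ^ (-1 / 2)`, so by the Poincaré
inequality the covariances of the entries of `g` are of order `1 / N ^ 2`. Hence
`z G_N = 1 + η(G_N) G_N` up to an error that tends to zero
(`IsGaussianBlockLaw.norm_equation_error_le`).

The passage to the limit is a compactness argument for the quadratic equation
`z • g = e + b g g` in a finite dimensional space. The `G_N` are bounded by `1 / Im z` and satisfy a
uniform second order Taylor estimate, so each ultrafilter limit is analytic and solves the equation.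
Any analytic solution that is `O(1 / Im z)` satisfies `z g(z) → e` along all of `|z| → ∞`
(`tendsto_smul_solution_cobounded`), because in the coordinate `w = 1 / z` it continues to the fixed
point of a contraction, which is analytic around `w = 0`. Analytic solutions with that asymptotic
behaviour are unique (`eqOn_of_analytic_solutions`), since for large `|z|` the equation is again a
contraction. So all limits agree and `G_N` converges (`exists_limit_solution`). Finally,
`i y tr_d G(i y) → 1` makes the averaged eigenvalue distributions tight, and a probability measure
is determined by its Cauchy transform, so they converge weakly
(`exists_tendsto_of_tendsto_cauchyTransform`).
-/

namespace BlockMatrix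

/-! ### Quadratic equations on the upper half plane -/

theorem isOpen_upperHalf : IsOpen upperHalf :=
  isOpen_lt continuous_const Complex.continuous_im

theorem convex_upperHalf : Convex ℝ upperHalf := convex_halfSpace_im_gt 0

theorem ne_zero_of_mem_upperHalf {z : ℂ} (hz : z ∈ upperHalf) : z ≠ 0 := by
  rintro rfl
  simp [upperHalf] at hz

section QuadraticEquation

variable {V : Type*} [NormedAddCommGroup V] [NormedSpace ℂ V]

theorem norm_quadratic_sub_le (b : V →L[ℂ] V →L[ℂ] V) (x y : V) :
    ‖b x x - b y y‖ ≤ ‖b‖ * (‖x‖ + ‖y‖) * ‖x - y‖ := by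
  have h : b x x - b y y = b x (x - y) + b (x - y) y := by simp [map_sub]
  rw [h]
  refine (norm_add_le _ _).trans ?_
  have h1 := b.le_opNorm₂ x (x - y)
  have h2 := b.le_opNorm₂ (x - y) y
  nlinarith

/-- The map `x ↦ w • (e + b x x)` is a contraction on small balls, so there approximate fixed
points are as close to each other as their errors. -/
theorem norm_sub_le_of_approx_fixedPoint (b : V →L[ℂ] V →L[ℂ] V) {e x y u v : V} {w : ℂ}
    (hx : x = w • (e + b x x) + u) (hy : y = w • (e + b y y) + v)
    (hw : ‖w‖ * (‖b‖ * (‖x‖ + ‖y‖)) ≤ 1 / 2) : ‖x - y‖ ≤ 2 * ‖u - v‖ := by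
  have h : x - y = w • (b x x - b y y) + (u - v) := by
    nth_rw 1 [hx, hy]
    simp only [smul_add, smul_sub]
    abel
  have h1 : ‖x - y‖ ≤ ‖w‖ * ‖b x x - b y y‖ + ‖u - v‖ := by
    nth_rw 1 [h]
    exact (norm_add_le _ _).trans (by rw [norm_smul])
  have h2 := mul_le_mul_of_nonneg_left (norm_quadratic_sub_le b x y) (norm_nonneg w)
  nlinarith [norm_nonneg (x - y)]

/-- Near infinity (in the coordinate `w = 1 / z`) the equation `z • g = e + b g g` has an analytic
solution of size `O(w)`, the limit of the fixed point iteration started at `0`. -/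
theorem exists_analytic_solution_near_zero [CompleteSpace V] (b : V →L[ℂ] V →L[ℂ] V) (e : V) :
    ∃ r > 0, ∃ h : ℂ → V, DifferentiableOn ℂ h (Metric.ball 0 r) ∧
      ∀ w ∈ Metric.ball (0 : ℂ) r, h w = w • (e + b (h w) (h w)) ∧ ‖h w‖ ≤ 2 * ‖e‖ * ‖w‖ := by
  -- For `‖w‖ < r` the iterates stay in the ball of radius `2 * ‖e‖ * ‖w‖`, on which
  -- `x ↦ w • (e + b x x)` is Lipschitz with constant at most `1 / 2`.
  set r : ℝ := 1 / (1 + 8 * ‖b‖ * ‖e‖) with hr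
  have hbe : 0 ≤ ‖b‖ * ‖e‖ := by positivity
  have hr0 : 0 < r := by positivity
  set T : ℂ → V → V := fun w x => w • (e + b x x) with hT
  have hsmall : ∀ w ∈ Metric.ball (0 : ℂ) r, ‖w‖ ≤ 1 ∧ ‖w‖ * (8 * ‖b‖ * ‖e‖) ≤ 1 := by
    intro w hw
    rw [mem_ball_zero_iff, hr, lt_div_iff₀ (by positivity)] at hw
    have := norm_nonneg w
    constructor <;> nlinarith [mul_nonneg this hbe]
  have hball : ∀ w ∈ Metric.ball (0 : ℂ) r, ∀ n, ‖(T w)^[n] 0‖ ≤ 2 * ‖e‖ * ‖w‖ := by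
    intro w hw n
    obtain ⟨h1, h2⟩ := hsmall w hw
    induction n with
    | zero => simp; positivity
    | succ n ih =>
      rw [Function.iterate_succ_apply']
      set x := (T w)^[n] 0
      have hb : ‖b x x‖ ≤ ‖b‖ * ‖x‖ * ‖x‖ := b.le_opNorm₂ x x
      have hx : ‖b‖ * ‖x‖ * ‖x‖ ≤ ‖b‖ * (2 * ‖e‖ * ‖w‖) * (2 * ‖e‖ * ‖w‖) := by gcongr
      have hw0 := norm_nonneg w
      have h3 : ‖b‖ * (2 * ‖e‖ * ‖w‖) * (2 * ‖e‖ * ‖w‖) ≤ ‖e‖ := by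
        have h4 : ‖b‖ * (2 * ‖e‖ * ‖w‖) * (2 * ‖e‖ * ‖w‖)
            = (‖w‖ * (8 * ‖b‖ * ‖e‖)) * (‖w‖ * ‖e‖ / 2) := by ring
        rw [h4]
        have h5 : ‖w‖ * ‖e‖ ≤ 1 * ‖e‖ := by gcongr
        have h6 : 0 ≤ ‖w‖ * ‖e‖ := by positivity
        nlinarith
      calc ‖T w x‖ = ‖w‖ * ‖e + b x x‖ := norm_smul _ _
        _ ≤ ‖w‖ * (‖e‖ + ‖e‖) := by
          gcongr
          exact (norm_add_le _ _).trans (by linarith)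
        _ = 2 * ‖e‖ * ‖w‖ := by ring
  have hdist : ∀ w ∈ Metric.ball (0 : ℂ) r, ∀ n,
      dist ((T w)^[n] 0) ((T w)^[n + 1] 0) ≤ ‖e‖ * (1 / 2) ^ n := by
    intro w hw n
    obtain ⟨h1, h2⟩ := hsmall w hw
    induction n with
    | zero =>
      simp only [hT, Function.iterate_zero, id_eq, zero_add, Function.iterate_one, map_zero,
        add_zero, dist_zero_left, pow_zero, mul_one, norm_smul]
      nlinarith [norm_nonneg e]
    | succ n ih =>
      rw [Function.iterate_succ_apply' _ (n + 1)]
      nth_rw 1 [Function.iterate_succ_apply' _ n]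
      set x := (T w)^[n] 0 with hx
      set y := (T w)^[n + 1] 0 with hy
      have hxb : ‖x‖ ≤ 2 * ‖e‖ * ‖w‖ := hball w hw n
      have hyb : ‖y‖ ≤ 2 * ‖e‖ * ‖w‖ := hball w hw (n + 1)
      have h3 : T w x - T w y = w • (b x x - b y y) := by
        simp only [hT, smul_add, smul_sub]; abel
      rw [dist_eq_norm] at ih
      rw [dist_eq_norm, h3, norm_smul]
      have hw0 := norm_nonneg w
      calc ‖w‖ * ‖b x x - b y y‖ ≤ ‖w‖ * (‖b‖ * (‖x‖ + ‖y‖) * ‖x - y‖) := by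
            gcongr; exact norm_quadratic_sub_le b x y
        _ ≤ ‖w‖ * (‖b‖ * (2 * ‖e‖ * ‖w‖ + 2 * ‖e‖ * ‖w‖) * (‖e‖ * (1 / 2) ^ n)) := by gcongr
        _ = (‖w‖ * (8 * ‖b‖ * ‖e‖)) * ‖w‖ * (‖e‖ * (1 / 2) ^ (n + 1)) := by ring
        _ ≤ 1 * 1 * (‖e‖ * (1 / 2) ^ (n + 1)) := by gcongr
        _ = ‖e‖ * (1 / 2) ^ (n + 1) := by ring
  have hlim : ∀ w, ∃ x, w ∈ Metric.ball (0 : ℂ) r →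
      Tendsto (fun n => (T w)^[n] 0) atTop (𝓝 x) := by
    intro w
    by_cases hw : w ∈ Metric.ball (0 : ℂ) r
    · obtain ⟨x, hx⟩ := cauchySeq_tendsto_of_complete
        (cauchySeq_of_le_geometric (1 / 2) ‖e‖ (by norm_num) (hdist w hw))
      exact ⟨x, fun _ => hx⟩
    · exact ⟨0, fun h => absurd h hw⟩
  choose h hh using hlim
  refine ⟨r, hr0, h, ?_, fun w hw => ⟨?_, ?_⟩⟩
  · have hunif : TendstoUniformlyOn (fun n w => (T w)^[n] 0) h atTop (Metric.ball 0 r) := by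
      rw [Metric.tendstoUniformlyOn_iff]
      intro ε hε
      have h0 : Tendsto (fun n : ℕ => ‖e‖ * (1 / 2 : ℝ) ^ n / (1 - 1 / 2)) atTop (𝓝 0) := by
        have := ((tendsto_pow_atTop_nhds_zero_of_lt_one (r := (1 / 2 : ℝ)) (by norm_num)
          (by norm_num)).const_mul ‖e‖).div_const (1 - 1 / 2)
        simpa using this
      filter_upwards [h0.eventually_lt_const hε] with n hn w hw
      rw [dist_comm]
      exact (dist_le_of_le_geometric_of_tendsto (1 / 2) ‖e‖ (by norm_num) (hdist w hw)
        (hh w hw) n).trans_lt hn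
    refine hunif.tendstoLocallyUniformlyOn.differentiableOn (Eventually.of_forall fun n => ?_)
      Metric.isOpen_ball
    refine Differentiable.differentiableOn ?_
    induction n with
    | zero => simp
    | succ n ih =>
      simp only [Function.iterate_succ_apply']
      simp only [hT]
      fun_prop
  · have h1 := hh w hw
    have h2 : Tendsto (fun n => (T w)^[n + 1] 0) atTop (𝓝 (w • (e + b (h w) (h w)))) := by
      simp only [Function.iterate_succ_apply']
      have hc : Continuous (T w) := by simp only [hT]; fun_prop
      exact (hc.tendsto (h w)).comp h1
    exact tendsto_nhds_unique ((tendsto_add_atTop_iff_nat 1).2 h1) h2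
  · exact le_of_tendsto (hh w hw).norm (Eventually.of_forall (hball w hw))

/-- An analytic solution on the upper half plane of `z • g = e + b g g` with `z • g → e` at infinity
is unique: two of them agree for large `|z|` by contractivity, hence everywhere. -/
theorem eqOn_of_analytic_solutions [CompleteSpace V] (b : V →L[ℂ] V →L[ℂ] V) (e : V)
    {G₁ G₂ : ℂ → V} (hd₁ : DifferentiableOn ℂ G₁ upperHalf) (hd₂ : DifferentiableOn ℂ G₂ upperHalf)
    (ht₁ : Tendsto (fun z => z • G₁ z) (Bornology.cobounded ℂ ⊓ 𝓟 upperHalf) (𝓝 e))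
    (ht₂ : Tendsto (fun z => z • G₂ z) (Bornology.cobounded ℂ ⊓ 𝓟 upperHalf) (𝓝 e))
    (he₁ : ∀ z ∈ upperHalf, z • G₁ z = e + b (G₁ z) (G₁ z))
    (he₂ : ∀ z ∈ upperHalf, z • G₂ z = e + b (G₂ z) (G₂ z)) :
    Set.EqOn G₁ G₂ upperHalf := by
  set F := Bornology.cobounded ℂ ⊓ 𝓟 upperHalf with hF
  have hlarge : ∀ᶠ z in F, 1 + 4 * ‖b‖ * (‖e‖ + 1) ≤ ‖z‖ :=
    (tendsto_norm_cobounded_atTop.mono_left inf_le_left).eventually_ge_atTop _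
  have hmem : ∀ᶠ z in F, z ∈ upperHalf :=
    (eventually_principal.2 fun _ h => h).filter_mono inf_le_right
  have hn₁ : ∀ᶠ z in F, ‖z • G₁ z‖ < ‖e‖ + 1 := ht₁.norm.eventually_lt_const (by linarith)
  have hn₂ : ∀ᶠ z in F, ‖z • G₂ z‖ < ‖e‖ + 1 := ht₂.norm.eventually_lt_const (by linarith)
  have heq : ∀ᶠ z in F, G₁ z = G₂ z := by
    filter_upwards [hlarge, hmem, hn₁, hn₂] with z hz hzm h₁ h₂
    have hz0 : z ≠ 0 := ne_zero_of_mem_upperHalf hzm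
    have hfix : ∀ g : V, z • g = e + b g g → g = z⁻¹ • (e + b g g) + 0 := by
      intro g hg
      rw [← hg, inv_smul_smul₀ hz0, add_zero]
    have hbe : 0 ≤ ‖b‖ * (‖e‖ + 1) := by positivity
    have hz1 : 1 ≤ ‖z‖ := by linarith
    have hzpos : 0 < ‖z‖ := by linarith
    have key := norm_sub_le_of_approx_fixedPoint b (hfix _ (he₁ z hzm)) (hfix _ (he₂ z hzm)) (by
      rw [norm_smul] at h₁ h₂
      rw [norm_inv, inv_mul_le_iff₀ hzpos]
      have h3 : ‖G₁ z‖ + ‖G₂ z‖ ≤ 2 * (‖e‖ + 1) := by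
        nlinarith [norm_nonneg (G₁ z), norm_nonneg (G₂ z)]
      nlinarith [mul_le_mul_of_nonneg_left h3 (norm_nonneg b)])
    simpa [sub_eq_zero] using key
  rw [hF, eventually_inf_principal,
    (Metric.hasBasis_cobounded_compl_closedBall (0 : ℂ)).eventually_iff] at heq
  obtain ⟨R, -, hR⟩ := heq
  -- `G₁` and `G₂` agree outside the disc of radius `R`, in particular near `z₀`; continue
  -- analytically from there.
  set z₀ : ℂ := (|R| + 1 : ℝ) * Complex.I with hz₀
  have hz₀m : z₀ ∈ upperHalf := by
    simp only [upperHalf, Set.mem_ofPred_eq, hz₀, Complex.im_ofReal_mul,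
      Complex.I_im, mul_one]
    positivity
  have hz₀n : z₀ ∈ (Metric.closedBall (0 : ℂ) R)ᶜ := by
    simp only [Set.mem_compl_iff, mem_closedBall_zero_iff, not_le, hz₀, norm_mul, Complex.norm_I,
      mul_one, Complex.norm_real, Real.norm_eq_abs]
    rw [abs_of_nonneg (by positivity)]
    linarith [le_abs_self R]
  refine (hd₁.analyticOnNhd isOpen_upperHalf).eqOn_of_preconnected_of_eventuallyEq
    (hd₂.analyticOnNhd isOpen_upperHalf) convex_upperHalf.isPreconnected hz₀m ?_
  filter_upwards [isOpen_upperHalf.mem_nhds hz₀m,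
    Metric.isClosed_closedBall.isOpen_compl.mem_nhds hz₀n] with z h1 h2 using hR h2 h1

theorem im_inv_pos_of_im_neg {w : ℂ} (hw : w.im < 0) : w⁻¹ ∈ upperHalf := by
  have h0 : w ≠ 0 := by rintro rfl; simp at hw
  have : 0 < Complex.normSq w := Complex.normSq_pos.2 h0
  simp only [upperHalf, Set.mem_ofPred_eq, Complex.inv_im]
  exact div_pos (by linarith) this

/-- A solution of `z • g = e + b g g` on the upper half plane which is `O(1 / Im z)` satisfies
`z • g → e` as `|z| → ∞`, even tangentially to the real axis: in the coordinate `w = 1 / z` it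
agrees with the solution that is analytic in a full neighbourhood of `w = 0`. -/
theorem tendsto_smul_solution_cobounded [CompleteSpace V] (b : V →L[ℂ] V →L[ℂ] V) (e : V)
    {G : ℂ → V} {K : ℝ} (hd : DifferentiableOn ℂ G upperHalf)
    (he : ∀ z ∈ upperHalf, z • G z = e + b (G z) (G z))
    (hK : ∀ z ∈ upperHalf, ‖G z‖ ≤ K / z.im) :
    Tendsto (fun z => z • G z) (Bornology.cobounded ℂ ⊓ 𝓟 upperHalf) (𝓝 e) := by
  obtain ⟨r, hr, h, hhd, hh⟩ := exists_analytic_solution_near_zero b e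
  have hK0 : 0 ≤ K := by
    have := (norm_nonneg _).trans (hK Complex.I (by simp [upperHalf]))
    simpa using this
  set D : Set ℂ := Metric.ball 0 r ∩ {w | w.im < 0} with hD
  have hDo : IsOpen D :=
    Metric.isOpen_ball.inter (isOpen_lt Complex.continuous_im continuous_const)
  have hDc : Convex ℝ D := (convex_ball 0 r).inter (convex_halfSpace_im_lt 0)
  have hGd : DifferentiableOn ℂ (fun w => G w⁻¹) D := by
    refine hd.comp (fun w hw => ?_) fun w hw => im_inv_pos_of_im_neg hw.2
    refine (differentiableAt_inv ?_).differentiableWithinAt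
    rintro rfl
    simpa using hw.2
  have hGe : ∀ w, w.im < 0 → G w⁻¹ = w • (e + b (G w⁻¹) (G w⁻¹)) := by
    intro w hw
    have hw0 : w ≠ 0 := by rintro rfl; simp at hw
    rw [← he _ (im_inv_pos_of_im_neg hw), smul_inv_smul₀ hw0]
  have hEq : Set.EqOn (fun w => G w⁻¹) h D := by
    -- Near the point `-t * I` of the imaginary axis, `1 / Im (w⁻¹)` is comparable to `‖w‖`, so that
    -- `G w⁻¹` is as small as `h w` and the two fixed points coincide.
    set t : ℝ := min (r / 2) (1 / (1 + ‖b‖ * (32 * K + 16 * ‖e‖))) with ht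
    have hc : 0 ≤ ‖b‖ * (32 * K + 16 * ‖e‖) := by positivity
    have ht0 : 0 < t := by positivity
    have htr : t ≤ r / 2 := min_le_left _ _
    have ht1 : t * (1 + ‖b‖ * (32 * K + 16 * ‖e‖)) ≤ 1 := by
      have := min_le_right (r / 2) (1 / (1 + ‖b‖ * (32 * K + 16 * ‖e‖)))
      rwa [← ht, le_div_iff₀ (by positivity)] at this
    set w₀ : ℂ := (-t : ℝ) * Complex.I with hw₀
    have hn : ‖w₀‖ = t := by
      simp [hw₀, abs_of_pos ht0]
    have hi : w₀.im = -t := by simp [hw₀]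
    have hw₀D : w₀ ∈ D := ⟨by rw [mem_ball_zero_iff, hn]; linarith, by
      simp only [Set.mem_ofPred_eq, hi]; linarith⟩
    refine (hGd.analyticOnNhd hDo).eqOn_of_preconnected_of_eventuallyEq
      ((hhd.mono Set.inter_subset_left).analyticOnNhd hDo) hDc.isPreconnected hw₀D ?_
    have e1 : ∀ᶠ w in 𝓝 w₀, ‖w‖ < 2 * t :=
      (continuous_norm.tendsto w₀).eventually_lt_const (by rw [hn]; linarith)
    have e2 : ∀ᶠ w in 𝓝 w₀, w.im < -t / 2 :=
      (Complex.continuous_im.tendsto w₀).eventually_lt_const (by rw [hi]; linarith)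
    filter_upwards [hDo.mem_nhds hw₀D, e1, e2] with w hwD hw1 hw2
    obtain ⟨hh1, hh2⟩ := hh w hwD.1
    have key := norm_sub_le_of_approx_fixedPoint b (w := w) (u := 0) (v := 0)
      (by rw [add_zero]; exact hGe w hwD.2) (by rw [add_zero]; exact hh1) (by
        have hg : ‖G w⁻¹‖ ≤ 8 * K * t := by
          refine (hK _ (im_inv_pos_of_im_neg hwD.2)).trans ?_
          have hns : Complex.normSq w ≤ 4 * t ^ 2 := by
            rw [Complex.normSq_eq_norm_sq]
            nlinarith [norm_nonneg w]
          have hw0 : w ≠ 0 := by rintro rfl; simp at hw2; linarith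
          have hns0 : 0 < Complex.normSq w := Complex.normSq_pos.2 hw0
          rw [Complex.inv_im, div_div_eq_mul_div, div_le_iff₀ (by linarith)]
          calc K * Complex.normSq w ≤ K * (4 * t ^ 2) := by gcongr
            _ = 8 * K * t * (t / 2) := by ring
            _ ≤ 8 * K * t * (-w.im) := by gcongr; linarith
        have hh3 : ‖h w‖ ≤ 4 * ‖e‖ * t := by nlinarith [norm_nonneg e]
        have ht2 : t ≤ 1 := by nlinarith
        calc ‖w‖ * (‖b‖ * (‖G w⁻¹‖ + ‖h w‖))
            ≤ (2 * t) * (‖b‖ * (8 * K * t + 4 * ‖e‖ * t)) := by gcongr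
          _ = (t * (‖b‖ * (32 * K + 16 * ‖e‖))) * (t / 2) := by ring
          _ ≤ 1 * (1 / 2) := by
            gcongr
            nlinarith
          _ = 1 / 2 := by norm_num)
    simpa [sub_eq_zero] using key
  have hinv : Tendsto (fun z : ℂ => z⁻¹) (Bornology.cobounded ℂ ⊓ 𝓟 upperHalf) (𝓝 0) :=
    tendsto_inv₀_cobounded.mono_left inf_le_left
  have hball : ∀ᶠ z : ℂ in Bornology.cobounded ℂ ⊓ 𝓟 upperHalf, z⁻¹ ∈ Metric.ball (0 : ℂ) r :=
    hinv.eventually (Metric.ball_mem_nhds 0 hr)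
  have hmem : ∀ᶠ z : ℂ in Bornology.cobounded ℂ ⊓ 𝓟 upperHalf, z ∈ upperHalf :=
    (eventually_principal.2 fun _ h => h).filter_mono inf_le_right
  have hGh : ∀ᶠ z : ℂ in Bornology.cobounded ℂ ⊓ 𝓟 upperHalf,
      G z = h z⁻¹ ∧ ‖h z⁻¹‖ ≤ 2 * ‖e‖ * ‖z⁻¹‖ := by
    filter_upwards [hball, hmem] with z hz hzm
    have hi : (z⁻¹).im < 0 := by
      rw [Complex.inv_im]
      exact div_neg_of_neg_of_pos (neg_neg_of_pos hzm)
        (Complex.normSq_pos.2 (ne_zero_of_mem_upperHalf hzm))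
    have := hEq ⟨hz, hi⟩
    simp only [inv_inv] at this
    exact ⟨this, (hh _ hz).2⟩
  have hG0 : Tendsto G (Bornology.cobounded ℂ ⊓ 𝓟 upperHalf) (𝓝 0) := by
    refine squeeze_zero_norm' (hGh.mono fun z hz => hz.1 ▸ hz.2) ?_
    simpa using hinv.norm.const_mul (2 * ‖e‖)
  have hlim : Tendsto (fun z => e + b (G z) (G z)) (Bornology.cobounded ℂ ⊓ 𝓟 upperHalf) (𝓝 e) := by
    have hc : Continuous fun x => e + b x x := by fun_prop
    simpa [Function.comp_def] using (hc.tendsto 0).comp hG0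
  exact hlim.congr' (hmem.mono fun z hz => (he z hz).symm)

/-- Along an ultrafilter, a family of functions bounded by `K / Im z`, with a uniform second order
Taylor bound, which solves `z • g = e + b g g` up to an error tending to `0`, has a limit, which is
an analytic solution. -/
theorem exists_ultrafilter_limit_solution [FiniteDimensional ℂ V] (b : V →L[ℂ] V →L[ℂ] V) (e : V)
    {G G' : ℕ → ℂ → V} {K : ℝ}
    (hK : ∀ N, ∀ z ∈ upperHalf, ‖G N z‖ ≤ K / z.im)
    (hK' : ∀ N, ∀ z ∈ upperHalf, ‖G' N z‖ ≤ K / z.im ^ 2)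
    (hT : ∀ N, ∀ z ∈ upperHalf, ∀ w ∈ upperHalf,
      ‖G N w - G N z - (w - z) • G' N z‖ ≤ K * ‖w - z‖ ^ 2 / (w.im * z.im ^ 2))
    (U : Ultrafilter ℕ)
    (he : ∀ z ∈ upperHalf, Tendsto (fun N => z • G N z - e - b (G N z) (G N z)) U (𝓝 0)) :
    ∃ g : ℂ → V, (∀ z ∈ upperHalf, Tendsto (fun N => G N z) U (𝓝 (g z))) ∧
      DifferentiableOn ℂ g upperHalf ∧ (∀ z ∈ upperHalf, z • g z = e + b (g z) (g z)) ∧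
      ∀ z ∈ upperHalf, ‖g z‖ ≤ K / z.im := by
  have : ProperSpace V := FiniteDimensional.proper ℂ V
  have hlim : ∀ (f : ℕ → V) (C : ℝ), (∀ N, ‖f N‖ ≤ C) → ∃ x, Tendsto f U (𝓝 x) := by
    intro f C hf
    obtain ⟨x, -, hx⟩ := (isCompact_closedBall (0 : V) C).ultrafilter_le_nhds (U.map f) (by
      rw [le_principal_iff]
      exact Filter.mem_map.2 (Filter.univ_mem' fun N => by simpa using hf N))
    exact ⟨x, hx⟩
  have hg : ∀ z, ∃ x, z ∈ upperHalf → Tendsto (fun N => G N z) U (𝓝 x) := by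
    intro z
    by_cases hz : z ∈ upperHalf
    · obtain ⟨x, hx⟩ := hlim _ _ fun N => hK N z hz
      exact ⟨x, fun _ => hx⟩
    · exact ⟨0, fun h => absurd h hz⟩
  choose g hg using hg
  refine ⟨g, hg, ?_, ?_, ?_⟩
  · intro z hz
    obtain ⟨L, hL⟩ := hlim _ _ fun N => hK' N z hz
    have hzpos : 0 < z.im := hz
    have hK0 : 0 ≤ K := by
      have := (norm_nonneg _).trans (hK 0 Complex.I (by simp [upperHalf]))
      simpa using this
    have hTay : ∀ w ∈ upperHalf,
        ‖g w - g z - (w - z) • L‖ ≤ K * ‖w - z‖ ^ 2 / (w.im * z.im ^ 2) := fun w hw =>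
      le_of_tendsto (((hg w hw).sub (hg z hz)).sub (hL.const_smul (w - z))).norm
        (Eventually.of_forall fun N => hT N z hz w hw)
    have hder : HasDerivAt g L z := by
      rw [hasDerivAt_iff_isLittleO]
      refine Asymptotics.IsBigO.trans_isLittleO ?_
        (Asymptotics.isLittleO_pow_sub_sub z (m := 2) (by norm_num))
      refine Asymptotics.IsBigO.of_bound (K / (z.im / 2 * z.im ^ 2)) ?_
      have e1 : ∀ᶠ w : ℂ in 𝓝 z, z.im / 2 < w.im :=
        (Complex.continuous_im.tendsto z).eventually_const_lt (by linarith)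
      filter_upwards [e1] with w hw
      have hwpos : 0 < w.im := by linarith
      refine (hTay w hwpos).trans ?_
      rw [norm_pow, norm_norm, div_mul_eq_mul_div]
      gcongr
    exact hder.differentiableAt.differentiableWithinAt
  · intro z hz
    have hc : Continuous fun x => z • x - e - b x x := by fun_prop
    have h1 := (hc.tendsto (g z)).comp (hg z hz)
    have h2 := tendsto_nhds_unique h1 (he z hz)
    rw [sub_sub, sub_eq_zero] at h2
    exact h2
  · intro z hz
    exact le_of_tendsto (hg z hz).norm (Eventually.of_forall fun N => hK N z hz)

/-- Approximate solutions on the upper half plane converge, pointwise, to an exact analytic solution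
with `z • g → e`: all ultrafilter limits are such solutions, hence equal. -/
theorem exists_limit_solution [FiniteDimensional ℂ V] (b : V →L[ℂ] V →L[ℂ] V) (e : V)
    {G G' : ℕ → ℂ → V} {K : ℝ}
    (hK : ∀ N, ∀ z ∈ upperHalf, ‖G N z‖ ≤ K / z.im)
    (hK' : ∀ N, ∀ z ∈ upperHalf, ‖G' N z‖ ≤ K / z.im ^ 2)
    (hT : ∀ N, ∀ z ∈ upperHalf, ∀ w ∈ upperHalf,
      ‖G N w - G N z - (w - z) • G' N z‖ ≤ K * ‖w - z‖ ^ 2 / (w.im * z.im ^ 2))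
    (he : ∀ z ∈ upperHalf, Tendsto (fun N => z • G N z - e - b (G N z) (G N z)) atTop (𝓝 0)) :
    ∃ g : ℂ → V, (∀ z ∈ upperHalf, Tendsto (fun N => G N z) atTop (𝓝 (g z))) ∧
      DifferentiableOn ℂ g upperHalf ∧ (∀ z ∈ upperHalf, z • g z = e + b (g z) (g z)) ∧
      Tendsto (fun z => z • g z) (Bornology.cobounded ℂ ⊓ 𝓟 upperHalf) (𝓝 e) := by
  have : CompleteSpace V := FiniteDimensional.complete ℂ V
  have hU : ∀ U : Ultrafilter ℕ, (U : Filter ℕ) ≤ atTop → ∃ g : ℂ → V,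
      (∀ z ∈ upperHalf, Tendsto (fun N => G N z) U (𝓝 (g z))) ∧
      DifferentiableOn ℂ g upperHalf ∧ (∀ z ∈ upperHalf, z • g z = e + b (g z) (g z)) ∧
      Tendsto (fun z => z • g z) (Bornology.cobounded ℂ ⊓ 𝓟 upperHalf) (𝓝 e) := by
    intro U hU
    obtain ⟨g, h1, h2, h3, h4⟩ := exists_ultrafilter_limit_solution b e hK hK' hT U
      fun z hz => (he z hz).mono_left hU
    exact ⟨g, h1, h2, h3, tendsto_smul_solution_cobounded b e h2 h3 h4⟩
  obtain ⟨g, -, h2, h3, h4⟩ := hU (Ultrafilter.of atTop) (Ultrafilter.of_le _)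
  refine ⟨g, fun z hz => ?_, h2, h3, h4⟩
  rw [tendsto_iff_ultrafilter]
  intro U hUt
  obtain ⟨g', h1', h2', h3', h4'⟩ := hU U hUt
  rw [← eqOn_of_analytic_solutions b e h2' h2 h4' h4 h3' h3 hz]
  exact h1' z hz

end QuadraticEquation

/-! ### The Cauchy transform and weak convergence -/

section CauchyTransform

theorem sub_ofReal_ne_zero {z : ℂ} (hz : z ∈ upperHalf) (t : ℝ) : z - t ≠ 0 := by
  intro h
  have : (z - t).im = 0 := by rw [h]; simp
  simp [upperHalf] at this hz
  linarith

theorem norm_inv_sub_ofReal_le {z : ℂ} (hz : z ∈ upperHalf) (t : ℝ) : ‖(z - t)⁻¹‖ ≤ 1 / z.im := by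
  have hz' : 0 < z.im := hz
  rw [norm_inv, ← one_div]
  have := Complex.abs_im_le_norm (z - t)
  simp only [Complex.sub_im, Complex.ofReal_im, sub_zero] at this
  exact one_div_le_one_div_of_le hz' ((le_abs_self _).trans this)

theorem measurable_inv_sub_ofReal (z : ℂ) : Measurable fun t : ℝ => (z - t)⁻¹ := by fun_prop

theorem integrable_inv_sub_ofReal_pow (μ : Measure ℝ) [IsFiniteMeasure μ] {z : ℂ}
    (hz : z ∈ upperHalf) (k : ℕ) : Integrable (fun t : ℝ => (z - t)⁻¹ ^ k) μ := by
  refine Integrable.of_bound ((measurable_inv_sub_ofReal z).pow_const k).aestronglyMeasurable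
    ((1 / z.im) ^ k) (Eventually.of_forall fun t => ?_)
  rw [norm_pow]
  exact pow_le_pow_left₀ (norm_nonneg _) (norm_inv_sub_ofReal_le hz t) k

/-- Differentiation under the integral sign; `k = 1` is the Cauchy transform. -/
theorem hasDerivAt_integral_inv_sub_pow (μ : Measure ℝ) [IsFiniteMeasure μ] {z : ℂ}
    (hz : z ∈ upperHalf) (k : ℕ) :
    HasDerivAt (fun z : ℂ => ∫ t : ℝ, (z - t)⁻¹ ^ k ∂μ)
      (∫ t : ℝ, -(k : ℂ) * (z - t)⁻¹ ^ (k + 1) ∂μ) z := by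
  have hz' : 0 < z.im := hz
  set s : Set ℂ := {w | z.im / 2 < w.im} with hs
  have hsn : s ∈ 𝓝 z :=
    (isOpen_lt continuous_const Complex.continuous_im).mem_nhds (by simp; linarith)
  have hsu : ∀ w ∈ s, w ∈ upperHalf := fun w hw => (half_pos hz').trans hw
  refine (hasDerivAt_integral_of_dominated_loc_of_deriv_le
    (F := fun (z : ℂ) (t : ℝ) => (z - t)⁻¹ ^ k)
    (F' := fun (z : ℂ) (t : ℝ) => -(k : ℂ) * (z - t)⁻¹ ^ (k + 1))
    (bound := fun _ => (k : ℝ) * (2 / z.im) ^ (k + 1)) hsn ?_ ?_ ?_ ?_ ?_ ?_).2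
  · exact Eventually.of_forall fun w =>
      ((measurable_inv_sub_ofReal w).pow_const k).aestronglyMeasurable
  · exact integrable_inv_sub_ofReal_pow μ hz k
  · exact (((measurable_inv_sub_ofReal z).pow_const (k + 1)).const_mul _).aestronglyMeasurable
  · refine Eventually.of_forall fun t w hw => ?_
    rw [norm_mul, norm_neg, Complex.norm_natCast, norm_pow]
    have hw' : z.im / 2 < w.im := hw
    gcongr
    refine (norm_inv_sub_ofReal_le (hsu w hw) t).trans ?_
    rw [div_le_div_iff₀ (by linarith) hz']
    linarith
  · exact integrable_const _
  · refine Eventually.of_forall fun t w hw => ?_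
    have hne := sub_ofReal_ne_zero (hsu w hw) t
    have h1 : HasDerivAt (fun w : ℂ => (w - t)⁻¹) (-1 / (w - t) ^ 2) w :=
      ((hasDerivAt_id w).sub_const (t : ℂ)).inv hne
    refine (h1.pow k).congr_deriv ?_
    rcases k with _ | k
    · simp
    · simp only [Nat.add_sub_cancel, inv_pow]
      field_simp
      ring

theorem cauchyTransform_eq_integral_inv (μ : Measure ℝ) (z : ℂ) :
    cauchyTransform μ z = ∫ t : ℝ, (z - t)⁻¹ ^ 1 ∂μ := by
  simp [cauchyTransform]

/-- The integrals of the powers of `1 / (z - t)` are, up to constants, derivatives of the Cauchy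
transform, so they are determined by it. -/
theorem integral_inv_sub_pow_eq_of_cauchyTransform_eq {μ ν : Measure ℝ} [IsFiniteMeasure μ]
    [IsFiniteMeasure ν] (h : Set.EqOn (cauchyTransform μ) (cauchyTransform ν) upperHalf) (k : ℕ) :
    ∀ z ∈ upperHalf, ∫ t : ℝ, (z - t)⁻¹ ^ (k + 1) ∂μ = ∫ t : ℝ, (z - t)⁻¹ ^ (k + 1) ∂ν := by
  induction k with
  | zero =>
    intro z hz
    rw [zero_add, ← cauchyTransform_eq_integral_inv, ← cauchyTransform_eq_integral_inv]
    exact h hz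
  | succ k ih =>
    intro z hz
    have h1 := hasDerivAt_integral_inv_sub_pow μ hz (k + 1)
    have h2 := hasDerivAt_integral_inv_sub_pow ν hz (k + 1)
    have h3 := h1.unique (h2.congr_of_eventuallyEq
      (Filter.mem_of_superset (isOpen_upperHalf.mem_nhds hz) ih))
    rw [integral_const_mul, integral_const_mul] at h3
    exact mul_left_cancel₀ (neg_ne_zero.2 (Nat.cast_ne_zero.2 k.succ_ne_zero)) h3

/-- `exp (i s t)` is the bounded pointwise limit of the functions `(1 - i s t / n) ^ (-n)`, which
are powers of resolvents. -/
theorem tendsto_integral_one_sub_div_pow_charFun (μ : Measure ℝ) [IsProbabilityMeasure μ] (s : ℝ) :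
    Tendsto (fun n : ℕ => ∫ t : ℝ, (1 + (-(s * t * Complex.I)) / n)⁻¹ ^ n ∂μ) atTop
      (𝓝 (charFun μ s)) := by
  rw [charFun_apply_real]
  refine tendsto_integral_of_dominated_convergence (fun _ => 1) (fun n => ?_) (integrable_const _)
    (fun n => Eventually.of_forall fun t => ?_) (Eventually.of_forall fun t => ?_)
  · exact Measurable.aestronglyMeasurable (by fun_prop)
  · rw [norm_pow, norm_inv]
    refine pow_le_one₀ (by positivity) (inv_le_one_of_one_le₀ ?_)
    have h := Complex.abs_re_le_norm (1 + (-(s * t * Complex.I)) / n)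
    have h2 : ((1 + (-(s * t * Complex.I)) / n : ℂ)).re = 1 := by
      simp [← Complex.ofReal_natCast, Complex.div_ofReal_re]
    rw [h2] at h
    simpa using h
  · have h := (Complex.tendsto_one_add_div_pow_exp (-(s * t * Complex.I))).inv₀
      (Complex.exp_ne_zero _)
    simpa [Complex.exp_neg, inv_pow] using h

/-- A probability measure on the line is determined by its Cauchy transform on the upper half
plane. -/
theorem measure_eq_of_cauchyTransform_eq {μ ν : Measure ℝ} [IsProbabilityMeasure μ]
    [IsProbabilityMeasure ν] (h : Set.EqOn (cauchyTransform μ) (cauchyTransform ν) upperHalf) :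
    μ = ν := by
  have hneg : ∀ s < 0, charFun μ s = charFun ν s := by
    intro s hs
    refine tendsto_nhds_unique_of_eventuallyEq (tendsto_integral_one_sub_div_pow_charFun μ s)
      (tendsto_integral_one_sub_div_pow_charFun ν s) ?_
    filter_upwards [eventually_gt_atTop 0] with n hn
    obtain ⟨k, rfl⟩ := Nat.exists_eq_add_one.2 hn
    -- With `n = k + 1` and `z = -i n / s` one has `1 - i s t / n = (i s / n) * (z - t)`.
    set z : ℂ := ((-((k + 1 : ℕ) : ℝ) / s : ℝ) : ℂ) * Complex.I with hz
    have hzm : z ∈ upperHalf := by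
      simp only [upperHalf, Set.mem_ofPred_eq, hz, Complex.im_ofReal_mul, Complex.I_im, mul_one]
      exact div_pos_of_neg_of_neg (neg_neg_of_pos (by positivity)) hs
    have hfac : ∀ t : ℝ, (1 + (-(s * t * Complex.I)) / ((k + 1 : ℕ) : ℂ))⁻¹ ^ (k + 1)
        = (s * Complex.I / ((k + 1 : ℕ) : ℂ))⁻¹ ^ (k + 1) * (z - t)⁻¹ ^ (k + 1) := by
      intro t
      rw [← mul_pow, ← mul_inv]
      congr 2
      have hk : ((k + 1 : ℕ) : ℂ) ≠ 0 := Nat.cast_ne_zero.2 k.succ_ne_zero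
      have hs' : (s : ℂ) ≠ 0 := Complex.ofReal_ne_zero.2 hs.ne
      rw [hz]
      push_cast at hk ⊢
      field_simp
      linear_combination ((k : ℂ) + 1) * Complex.I_sq
    simp_rw [hfac, integral_const_mul]
    rw [integral_inv_sub_pow_eq_of_cauchyTransform_eq h k z hzm]
  refine Measure.ext_of_charFun (funext fun s => ?_)
  rcases lt_trichotomy s 0 with hs | rfl | hs
  · exact hneg s hs
  · simp
  · have := hneg (-s) (by linarith)
    rw [charFun_neg, charFun_neg] at this
    exact (starRingEnd ℂ).injective this

/-- Tail bound: `1 - i y G(i y)` has real part `∫ t² / (y² + t²)`. -/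
theorem measure_lt_norm_le (μ : Measure ℝ) [IsProbabilityMeasure μ] {y : ℝ} (hy : 0 < y) :
    μ {t | y < ‖t‖} ≤
      ENNReal.ofReal (2 * ‖1 - (y * Complex.I) * cauchyTransform μ (y * Complex.I)‖) := by
  have hz : (y * Complex.I : ℂ) ∈ upperHalf := by simpa [upperHalf] using hy
  have hint : Integrable (fun t : ℝ => 1 - (y * Complex.I) * (y * Complex.I - t)⁻¹) μ := by
    have := integrable_inv_sub_ofReal_pow μ hz 1
    simp only [pow_one] at this
    exact (integrable_const _).sub (this.const_mul _)
  have hre : ∀ t : ℝ, (1 - (y * Complex.I) * (y * Complex.I - t)⁻¹ : ℂ).re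
      = t ^ 2 / (y ^ 2 + t ^ 2) := by
    intro t
    have hne : y ^ 2 + t ^ 2 ≠ 0 := by positivity
    have hns : Complex.normSq (y * Complex.I - t) = y ^ 2 + t ^ 2 := by
      simp [Complex.normSq_apply]; ring
    simp only [Complex.sub_re, Complex.one_re, Complex.mul_re, Complex.inv_re, Complex.inv_im, hns,
      Complex.ofReal_re, Complex.ofReal_im, Complex.I_re, Complex.I_im, Complex.sub_im,
      Complex.mul_im]
    field_simp
    ring
  have heq : 1 - (y * Complex.I) * cauchyTransform μ (y * Complex.I)
      = ∫ t : ℝ, (1 - (y * Complex.I) * (y * Complex.I - t)⁻¹) ∂μ := by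
    have := integrable_inv_sub_ofReal_pow μ hz 1
    simp only [pow_one] at this
    rw [integral_sub (integrable_const _) (this.const_mul _), integral_const_mul]
    simp [cauchyTransform]
  have hre2 : (1 - (y * Complex.I) * cauchyTransform μ (y * Complex.I)).re
      = ∫ t : ℝ, t ^ 2 / (y ^ 2 + t ^ 2) ∂μ := by
    rw [heq]
    have := integral_re hint
    simp only [RCLike.re_to_complex] at this
    rw [← this]
    simp only [hre]
  have hint' : Integrable (fun t : ℝ => t ^ 2 / (y ^ 2 + t ^ 2)) μ := by
    simpa only [RCLike.re_to_complex, hre] using hint.re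
  have hmark := mul_meas_ge_le_integral_of_nonneg
    (Eventually.of_forall fun t => by positivity) hint' (1 / 2)
  have hsub : {t : ℝ | y < ‖t‖} ⊆ {t | 1 / 2 ≤ t ^ 2 / (y ^ 2 + t ^ 2)} := by
    intro t ht
    have ht' : y < |t| := ht
    rw [Set.mem_ofPred_eq, div_le_div_iff₀ (by norm_num) (by positivity)]
    nlinarith [sq_abs t, abs_nonneg t]
  rw [← ofReal_measureReal]
  refine ENNReal.ofReal_le_ofReal ?_
  have h1 := measureReal_mono (μ := μ) hsub
  have h2 := Complex.re_le_norm (1 - (y * Complex.I) * cauchyTransform μ (y * Complex.I))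
  linarith

/-- The tail bound passes to the limit: by `i y g(i y) → 1` no mass escapes to infinity. -/
theorem isTightMeasureSet_range_of_tendsto_cauchyTransform {μ : ℕ → Measure ℝ}
    [∀ n, IsProbabilityMeasure (μ n)] {g : ℂ → ℂ}
    (hg : ∀ z ∈ upperHalf, Tendsto (fun n => cauchyTransform (μ n) z) atTop (𝓝 (g z)))
    (hg1 : Tendsto (fun y : ℝ => (y * Complex.I) * g (y * Complex.I)) atTop (𝓝 1)) :
    IsTightMeasureSet (Set.range μ) := by
  refine isTightMeasureSet_range_of_tendsto_limsup_measure_norm_gt ?_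
  have h0 : Tendsto (fun y : ℝ => ENNReal.ofReal
      (2 * ‖1 - (y * Complex.I) * g (y * Complex.I)‖)) atTop (𝓝 0) := by
    have := ENNReal.tendsto_ofReal (((tendsto_const_nhds (x := (1 : ℂ))).sub hg1).norm.const_mul 2)
    simpa using this
  refine tendsto_of_tendsto_of_tendsto_of_le_of_le' tendsto_const_nhds h0
    (Eventually.of_forall fun _ => zero_le) ?_
  filter_upwards [eventually_gt_atTop 0] with y hy
  have hz : (y * Complex.I : ℂ) ∈ upperHalf := by simpa [upperHalf] using hy
  have h1 : Tendsto (fun n => ENNReal.ofReal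
      (2 * ‖1 - (y * Complex.I) * cauchyTransform (μ n) (y * Complex.I)‖)) atTop
      (𝓝 (ENNReal.ofReal (2 * ‖1 - (y * Complex.I) * g (y * Complex.I)‖))) :=
    ENNReal.tendsto_ofReal (((tendsto_const_nhds (x := (1 : ℂ))).sub
      ((hg _ hz).const_mul _)).norm.const_mul 2)
  rw [← h1.limsup_eq]
  exact limsup_le_limsup (Eventually.of_forall fun n => measure_lt_norm_le (μ n) hy)

/-- Continuity theorem for the Cauchy transform: if the Cauchy transforms converge pointwise to `g`,
and `i y g(i y) → 1` (no mass escapes), then the measures converge weakly, and `g` is the Cauchy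
transform of the limit. -/
theorem exists_tendsto_of_tendsto_cauchyTransform (μ : ℕ → ProbabilityMeasure ℝ) {g : ℂ → ℂ}
    (hg : ∀ z ∈ upperHalf, Tendsto (fun n => cauchyTransform (μ n) z) atTop (𝓝 (g z)))
    (hg1 : Tendsto (fun y : ℝ => (y * Complex.I) * g (y * Complex.I)) atTop (𝓝 1)) :
    ∃ ν : ProbabilityMeasure ℝ, Tendsto μ atTop (𝓝 ν) ∧
      ∀ z ∈ upperHalf, cauchyTransform ν z = g z := by
  have htight := isTightMeasureSet_range_of_tendsto_cauchyTransform hg hg1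
  have hcomp : IsCompact (closure (Set.range μ)) := by
    refine isCompact_closure_of_isTightMeasureSet (htight.subset ?_)
    rintro _ ⟨_, ⟨n, rfl⟩, rfl⟩
    exact ⟨n, rfl⟩
  have hU : ∀ U : Ultrafilter ℕ, (U : Filter ℕ) ≤ atTop → ∃ ν : ProbabilityMeasure ℝ,
      Tendsto μ U (𝓝 ν) ∧ ∀ z ∈ upperHalf, cauchyTransform ν z = g z := by
    intro U hU
    obtain ⟨ν, -, hν⟩ := hcomp.ultrafilter_le_nhds (U.map μ) (by
      rw [le_principal_iff]
      exact Filter.mem_map.2 (Filter.univ_mem' fun n => subset_closure ⟨n, rfl⟩))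
    have hν' : Tendsto μ U (𝓝 ν) := hν
    refine ⟨ν, hν', fun z hz => ?_⟩
    have h1 := hν'
    rw [ProbabilityMeasure.tendsto_iff_forall_integral_rclike_tendsto ℂ] at h1
    have hcont : Continuous fun t : ℝ => 1 / (z - t) := by
      refine continuous_const.div (by fun_prop) (sub_ofReal_ne_zero hz)
    have h2 := h1 (BoundedContinuousFunction.ofNormedAddCommGroup (fun t : ℝ => 1 / (z - t)) hcont
      (1 / z.im) fun t => by rw [one_div]; exact norm_inv_sub_ofReal_le hz t)
    exact tendsto_nhds_unique h2 ((hg z hz).mono_left hU)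
  obtain ⟨ν, -, hν⟩ := hU (Ultrafilter.of atTop) (Ultrafilter.of_le _)
  refine ⟨ν, ?_, hν⟩
  rw [tendsto_iff_ultrafilter]
  intro U hUt
  obtain ⟨ν', h1, h2⟩ := hU U hUt
  have heq : (ν' : Measure ℝ) = ν :=
    measure_eq_of_cauchyTransform_eq fun z hz => (h2 z hz).trans (hν z hz).symm
  exact (Subtype.ext heq : ν' = ν) ▸ h1

end CauchyTransform

/-! ### Resolvents and eigenvalue distributions -/

section Resolvent

open scoped Matrix.Norms.L2Operator
open Matrix

variable {ι : Type*} [Fintype ι] [DecidableEq ι]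

/-- The resolvent `(z - X)⁻¹` of a square matrix. It has a junk value if `z` is an eigenvalue of
`X`, which does not happen for selfadjoint `X` and `z` in the upper half plane. -/
noncomputable def resolventMatrix (z : ℂ) (X : Matrix ι ι ℂ) : Matrix ι ι ℂ := (z • 1 - X)⁻¹

/-- Functional calculus for polynomials: `p(X)` is diagonal in the eigenbasis of `X`. -/
theorem aeval_eq_conj_diagonal {X : Matrix ι ι ℂ} (hX : X.IsHermitian) (p : Polynomial ℂ) :
    Polynomial.aeval X p = Unitary.conjStarAlgAut ℂ _ hX.eigenvectorUnitary
      (diagonal fun i => p.eval (hX.eigenvalues i : ℂ)) := by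
  conv_lhs => rw [hX.spectral_theorem]
  rw [Polynomial.aeval_algHom_apply]
  congr 1
  have h := Polynomial.aeval_algHom_apply (Matrix.diagonalAlgHom (n := ι) (α := ℂ) ℂ)
    (RCLike.ofReal ∘ hX.eigenvalues : ι → ℂ) p
  simp only [Matrix.diagonalAlgHom_apply] at h
  rw [h, Polynomial.aeval_pi_apply]
  rfl

theorem aeval_inv_eq_conj_diagonal {X : Matrix ι ι ℂ} (hX : X.IsHermitian) (p : Polynomial ℂ)
    (hp : ∀ i, p.eval (hX.eigenvalues i : ℂ) ≠ 0) :
    (Polynomial.aeval X p)⁻¹ = Unitary.conjStarAlgAut ℂ _ hX.eigenvectorUnitary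
      (diagonal fun i => (p.eval (hX.eigenvalues i : ℂ))⁻¹) := by
  refine Matrix.inv_eq_right_inv ?_
  rw [aeval_eq_conj_diagonal hX, ← map_mul, diagonal_mul_diagonal]
  simp [hp]

theorem aeval_mul_inv {X : Matrix ι ι ℂ} (hX : X.IsHermitian) (p : Polynomial ℂ)
    (hp : ∀ i, p.eval (hX.eigenvalues i : ℂ) ≠ 0) :
    Polynomial.aeval X p * (Polynomial.aeval X p)⁻¹ = 1 := by
  rw [aeval_inv_eq_conj_diagonal hX p hp, aeval_eq_conj_diagonal hX, ← map_mul,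
    diagonal_mul_diagonal]
  simp [hp]

theorem trace_conjStarAlgAut (U : unitary (Matrix ι ι ℂ)) (A : Matrix ι ι ℂ) :
    (Unitary.conjStarAlgAut ℂ _ U A).trace = A.trace := by
  rw [Unitary.conjStarAlgAut_apply, Matrix.trace_mul_comm, ← mul_assoc, Unitary.coe_star_mul_self,
    one_mul]

theorem norm_conjStarAlgAut (U : unitary (Matrix ι ι ℂ)) (A : Matrix ι ι ℂ) :
    ‖Unitary.conjStarAlgAut ℂ _ U A‖ = ‖A‖ := by
  rw [Unitary.conjStarAlgAut_apply, ← Unitary.coe_star, CStarRing.norm_mul_coe_unitary,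
    CStarRing.norm_coe_unitary_mul]

theorem trace_aeval_inv {X : Matrix ι ι ℂ} (hX : X.IsHermitian) (p : Polynomial ℂ)
    (hp : ∀ i, p.eval (hX.eigenvalues i : ℂ) ≠ 0) :
    (Polynomial.aeval X p)⁻¹.trace = ∑ i, (p.eval (hX.eigenvalues i : ℂ))⁻¹ := by
  rw [aeval_inv_eq_conj_diagonal hX p hp, trace_conjStarAlgAut, trace_diagonal]

theorem resolventMatrix_eq_aeval_inv (z : ℂ) (X : Matrix ι ι ℂ) :
    resolventMatrix z X = (Polynomial.aeval X (Polynomial.C z - Polynomial.X))⁻¹ := by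
  simp [resolventMatrix, Algebra.algebraMap_eq_smul_one]

theorem eval_C_sub_X_ne_zero {z : ℂ} (hz : z ∈ upperHalf) (t : ℝ) :
    (Polynomial.C z - Polynomial.X).eval (t : ℂ) ≠ 0 := by
  simpa using sub_ofReal_ne_zero hz t

theorem trace_resolventMatrix {X : Matrix ι ι ℂ} (hX : X.IsHermitian) {z : ℂ}
    (hz : z ∈ upperHalf) :
    (resolventMatrix z X).trace = ∑ i, (z - hX.eigenvalues i)⁻¹ := by
  rw [resolventMatrix_eq_aeval_inv, trace_aeval_inv hX _ fun i => eval_C_sub_X_ne_zero hz _]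
  simp

theorem norm_resolventMatrix_le {X : Matrix ι ι ℂ} (hX : X.IsHermitian) {z : ℂ}
    (hz : z ∈ upperHalf) : ‖resolventMatrix z X‖ ≤ 1 / z.im := by
  have hz' : 0 < z.im := hz
  rw [resolventMatrix_eq_aeval_inv,
    aeval_inv_eq_conj_diagonal hX _ fun i => eval_C_sub_X_ne_zero hz _, norm_conjStarAlgAut,
    l2_opNorm_diagonal, pi_norm_le_iff_of_nonneg (by positivity)]
  intro i
  simpa using norm_inv_sub_ofReal_le hz (hX.eigenvalues i)

theorem sub_mul_resolventMatrix {X : Matrix ι ι ℂ} (hX : X.IsHermitian) {z : ℂ}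
    (hz : z ∈ upperHalf) : (z • 1 - X) * resolventMatrix z X = 1 := by
  have h := aeval_mul_inv hX (Polynomial.C z - Polynomial.X) fun i => eval_C_sub_X_ne_zero hz _
  rw [← resolventMatrix_eq_aeval_inv] at h
  simpa [Algebra.algebraMap_eq_smul_one] using h

theorem resolventMatrix_mul_sub {X : Matrix ι ι ℂ} (hX : X.IsHermitian) {z : ℂ}
    (hz : z ∈ upperHalf) : resolventMatrix z X * (z • 1 - X) = 1 :=
  mul_eq_one_comm.1 (sub_mul_resolventMatrix hX hz)

/-- The resolvent identity, varying the spectral parameter and the matrix. -/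
theorem resolventMatrix_sub {X Y : Matrix ι ι ℂ} (hX : X.IsHermitian) (hY : Y.IsHermitian) {z w : ℂ}
    (hz : z ∈ upperHalf) (hw : w ∈ upperHalf) :
    resolventMatrix w Y - resolventMatrix z X =
      resolventMatrix w Y * (Y - X - (w - z) • 1) * resolventMatrix z X := by
  have h : Y - X - (w - z) • (1 : Matrix ι ι ℂ) = (z • 1 - X) - (w • 1 - Y) := by
    rw [sub_smul]; abel
  rw [h, mul_sub, sub_mul, mul_assoc, sub_mul_resolventMatrix hX hz, resolventMatrix_mul_sub hY hw]
  simp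

/-- The second order Taylor formula in `z`, with its exact remainder. -/
theorem resolventMatrix_taylor {X : Matrix ι ι ℂ} (hX : X.IsHermitian) {z w : ℂ}
    (hz : z ∈ upperHalf) (hw : w ∈ upperHalf) :
    resolventMatrix w X - resolventMatrix z X
        - (w - z) • -(resolventMatrix z X * resolventMatrix z X)
      = (w - z) ^ 2 • (resolventMatrix w X * (resolventMatrix z X * resolventMatrix z X)) := by
  have h := resolventMatrix_sub hX hX hz hw
  set R := resolventMatrix z X
  set S := resolventMatrix w X
  have h1 : S = R - (w - z) • (S * R) := by
    rw [sub_self, zero_sub, mul_neg, neg_mul, mul_smul_comm, mul_one, smul_mul_assoc] at h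
    rw [sub_eq_iff_eq_add'] at h
    rw [sub_eq_add_neg]
    exact h
  have h2 : S * R = R * R - (w - z) • (S * (R * R)) := by
    nth_rw 1 [h1]
    rw [sub_mul, smul_mul_assoc, mul_assoc]
  nth_rw 1 [h1]
  rw [h2, smul_sub, smul_smul, smul_neg, pow_two (w - z)]
  abel

theorem norm_entry_le_l2_opNorm (A : Matrix ι ι ℂ) (i j : ι) : ‖A i j‖ ≤ ‖A‖ := by
  have h := A.l2_opNorm_mulVec (EuclideanSpace.single j 1)
  have h2 := PiLp.norm_apply_le ((EuclideanSpace.equiv ι ℂ).symm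
    (A *ᵥ (EuclideanSpace.single j (1 : ℂ)))) i
  simpa using h2.trans h

/-- Left multiplication by `A` has norm at most `‖A‖` for the Hilbert-Schmidt norm. -/
theorem sum_norm_sq_mul_le (A B : Matrix ι ι ℂ) :
    ∑ i, ∑ j, ‖(A * B) i j‖ ^ 2 ≤ ‖A‖ ^ 2 * ∑ i, ∑ j, ‖B i j‖ ^ 2 := by
  rw [Finset.sum_comm, Finset.sum_comm (f := fun i j => ‖B i j‖ ^ 2), Finset.mul_sum]
  refine Finset.sum_le_sum fun j _ => ?_
  have h := A.l2_opNorm_mulVec (WithLp.toLp 2 (fun i => B i j))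
  have h2 := pow_le_pow_left₀ (norm_nonneg _) h 2
  rw [mul_pow, EuclideanSpace.norm_sq_eq, EuclideanSpace.norm_sq_eq] at h2
  exact h2

theorem sum_norm_sq_mul_le_right (A B : Matrix ι ι ℂ) :
    ∑ i, ∑ j, ‖(B * A) i j‖ ^ 2 ≤ ‖A‖ ^ 2 * ∑ i, ∑ j, ‖B i j‖ ^ 2 := by
  have h := sum_norm_sq_mul_le Aᴴ Bᴴ
  rw [← conjTranspose_mul, l2_opNorm_conjTranspose] at h
  simp only [conjTranspose_apply, norm_star] at h
  rw [Finset.sum_comm, Finset.sum_comm (f := fun i j => ‖B i j‖ ^ 2)]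
  exact h

end Resolvent

section EigenvalueDistribution

variable {ι : Type*} [Fintype ι]

theorem eigenvalueDistribution_of_not_isHermitian {X : Matrix ι ι ℂ} (hX : ¬ X.IsHermitian) :
    eigenvalueDistribution X = 0 := dif_neg hX

theorem eigenvalueDistribution_of_isHermitian [DecidableEq ι] {X : Matrix ι ι ℂ}
    (hX : X.IsHermitian) : eigenvalueDistribution X =
      (Fintype.card ι : ENNReal)⁻¹ • ∑ i, Measure.dirac (hX.eigenvalues i) := by
  rw [eigenvalueDistribution, dif_pos hX]
  congr!

theorem eigenvalueDistribution_univ_le_one (X : Matrix ι ι ℂ) :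
    eigenvalueDistribution X Set.univ ≤ 1 := by
  classical
  by_cases hX : X.IsHermitian
  · rw [eigenvalueDistribution_of_isHermitian hX]
    simp [ENNReal.inv_mul_le_one]
  · rw [eigenvalueDistribution_of_not_isHermitian hX]
    simp

instance (X : Matrix ι ι ℂ) : IsFiniteMeasure (eigenvalueDistribution X) :=
  ⟨(eigenvalueDistribution_univ_le_one X).trans_lt ENNReal.one_lt_top⟩

theorem isProbabilityMeasure_eigenvalueDistribution [Nonempty ι] {X : Matrix ι ι ℂ}
    (hX : X.IsHermitian) : IsProbabilityMeasure (eigenvalueDistribution X) := by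
  classical
  constructor
  rw [eigenvalueDistribution_of_isHermitian hX]
  simp [ENNReal.inv_mul_cancel]

theorem integral_eigenvalueDistribution [DecidableEq ι] {X : Matrix ι ι ℂ} (hX : X.IsHermitian)
    {E : Type*} [NormedAddCommGroup E] [NormedSpace ℝ E] [CompleteSpace E] (f : ℝ → E) :
    ∫ t, f t ∂eigenvalueDistribution X
      = (Fintype.card ι : ℝ)⁻¹ • ∑ i, f (hX.eigenvalues i) := by
  rw [eigenvalueDistribution_of_isHermitian hX, integral_smul_measure,
    integral_finsetSum_measure fun i _ => integrable_dirac (by simp)]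
  simp [integral_dirac]

section Measurability

variable [DecidableEq ι] {α : Type*} [MeasurableSpace α] {X : α → Matrix ι ι ℂ}

theorem measurable_pow_entry (hX : ∀ i j, Measurable fun ω => X ω i j) (n : ℕ) :
    ∀ i j, Measurable fun ω => (X ω ^ n) i j := by
  induction n with
  | zero => simp
  | succ n ih =>
    intro i j
    simp only [pow_succ, Matrix.mul_apply]
    exact Finset.measurable_sum _ fun k _ => (ih i k).mul (hX k j)

theorem measurable_aeval_entry (hX : ∀ i j, Measurable fun ω => X ω i j) (p : Polynomial ℂ)
    (i j : ι) : Measurable fun ω => (Polynomial.aeval (X ω) p) i j := by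
  simp only [Polynomial.aeval_eq_sum_range, Matrix.sum_apply, Matrix.smul_apply,
    smul_eq_mul]
  exact Finset.measurable_sum _ fun k _ => (measurable_pow_entry hX k i j).const_mul _

theorem measurable_det_of_entry (hX : ∀ i j, Measurable fun ω => X ω i j) :
    Measurable fun ω => (X ω).det := by
  simp only [Matrix.det_apply]
  exact Finset.measurable_sum _ fun s _ =>
    (Finset.measurable_prod _ fun k _ => hX (s k) k).const_smul _

theorem measurable_inv_entry (hX : ∀ i j, Measurable fun ω => X ω i j) (i j : ι) :
    Measurable fun ω => (X ω)⁻¹ i j := by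
  simp only [Matrix.inv_def, Matrix.smul_apply, Matrix.adjugate_apply, Ring.inverse_eq_inv',
    smul_eq_mul]
  refine (measurable_det_of_entry hX).inv.mul (measurable_det_of_entry fun k l => ?_)
  simp only [Matrix.updateRow_apply]
  split_ifs
  · exact measurable_const
  · exact hX k l

theorem measurable_resolventMatrix_entry (hX : ∀ i j, Measurable fun ω => X ω i j) (z : ℂ)
    (i j : ι) : Measurable fun ω => resolventMatrix z (X ω) i j := by
  simp only [resolventMatrix_eq_aeval_inv]
  exact measurable_inv_entry (measurable_aeval_entry hX _) i j

omit [Fintype ι] [DecidableEq ι] in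
theorem measurableSet_isHermitian [Countable ι] (hX : ∀ i j, Measurable fun ω => X ω i j) :
    MeasurableSet {ω | (X ω).IsHermitian} := by
  simp only [Matrix.IsHermitian.ext_iff, Set.ofPred_forall]
  exact MeasurableSet.iInter fun i => MeasurableSet.iInter fun j =>
    measurableSet_eq_fun (Complex.continuous_conj.measurable.comp (hX j i)) (hX i j)

omit [DecidableEq ι] in
/-- For a polynomial without zeros on the real line, `∫ 1 / p` against the eigenvalue distribution
is the normalized trace of `p(X)⁻¹`, hence a measurable function of the matrix. -/
theorem measurable_integral_inv_eval_eigenvalueDistribution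
    (hX : ∀ i j, Measurable fun ω => X ω i j) (p : Polynomial ℂ)
    (hp : ∀ t : ℝ, p.eval (t : ℂ) ≠ 0) :
    Measurable fun ω => ∫ t : ℝ, (p.eval (t : ℂ))⁻¹ ∂eigenvalueDistribution (X ω) := by
  classical
  have h : (fun ω => ∫ t : ℝ, (p.eval (t : ℂ))⁻¹ ∂eigenvalueDistribution (X ω))
      = {ω | (X ω).IsHermitian}.indicator
        fun ω => (Fintype.card ι : ℂ)⁻¹ * ((Polynomial.aeval (X ω) p)⁻¹).trace := by
    funext ω
    by_cases hω : (X ω).IsHermitian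
    · rw [Set.indicator_of_mem (by exact hω), integral_eigenvalueDistribution hω,
        trace_aeval_inv hω p fun i => hp _, Complex.real_smul]
      simp
    · rw [Set.indicator_of_notMem (by exact hω), eigenvalueDistribution_of_not_isHermitian hω,
        integral_zero_measure]
  rw [h]
  refine Measurable.indicator ?_ (measurableSet_isHermitian hX)
  simp only [Matrix.trace, Matrix.diag_apply]
  exact (Finset.measurable_sum _ fun i _ =>
    measurable_inv_entry (measurable_aeval_entry hX p) i i).const_mul _

theorem tendsto_inv_one_add_mul_pow_indicator (q : ℝ) (hq : 0 ≤ q) :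
    Tendsto (fun k : ℕ => (1 + k * q ^ k)⁻¹) atTop (𝓝 ((Set.Iio 1).indicator 1 q)) := by
  by_cases h : q < 1
  · rw [Set.indicator_of_mem (by exact h)]
    have := ((tendsto_self_mul_const_pow_of_lt_one hq h).const_add 1).inv₀ (by simp)
    simpa using this
  · rw [Set.indicator_of_notMem (by exact h)]
    refine (tendsto_atTop_mono (fun k => ?_) tendsto_natCast_atTop_atTop).inv_tendsto_atTop
    have : 1 ≤ q ^ k := one_le_pow₀ (not_lt.1 h)
    nlinarith [Nat.cast_nonneg (α := ℝ) k]

omit [DecidableEq ι] in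
/-- The indicator of a bounded open interval is a bounded pointwise limit of the functions
`1 / (1 + k q ^ k)` with `q` a quadratic polynomial. -/
theorem measurable_eigenvalueDistribution_Ioo (hX : ∀ i j, Measurable fun ω => X ω i j) {a b : ℝ}
    (hab : a < b) : Measurable fun ω => eigenvalueDistribution (X ω) (Set.Ioo a b) := by
  set c := (a + b) / 2 with hc
  set ρ := (b - a) / 2 with hρ
  have hρ0 : 0 < ρ := by rw [hρ]; linarith
  set q : ℝ → ℝ := fun t => ((t - c) / ρ) ^ 2 with hqdef
  have hq0 : ∀ t, 0 ≤ q t := fun t => sq_nonneg _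
  have hq : Measurable q := by fun_prop
  set p : ℕ → Polynomial ℂ := fun k => 1 + Polynomial.C (k : ℂ) *
    ((Polynomial.C (ρ : ℂ)⁻¹ * (Polynomial.X - Polynomial.C (c : ℂ))) ^ 2) ^ k with hp
  have hpe : ∀ k (t : ℝ), (p k).eval (t : ℂ) = ((1 + k * q t ^ k : ℝ) : ℂ) := by
    intro k t
    simp only [hp, hqdef, Polynomial.eval_add, Polynomial.eval_one, Polynomial.eval_mul,
      Polynomial.eval_C, Polynomial.eval_pow, Polynomial.eval_sub, Polynomial.eval_X]
    push_cast
    rw [div_eq_inv_mul]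
  have hpos : ∀ (k : ℕ) (t : ℝ), 0 < 1 + k * q t ^ k := fun k t => by
    have := hq0 t
    positivity
  have hmeas : ∀ k : ℕ, Measurable fun ω =>
      ∫ t : ℝ, (1 + k * q t ^ k)⁻¹ ∂eigenvalueDistribution (X ω) := by
    intro k
    have h := Complex.measurable_re.comp
      (measurable_integral_inv_eval_eigenvalueDistribution hX (p k) fun t => by
        rw [hpe]
        exact Complex.ofReal_ne_zero.2 (hpos k t).ne')
    convert h using 1
    funext ω
    simp only [Function.comp_apply, hpe]
    rw [← Complex.ofReal_re (∫ t : ℝ, (1 + k * q t ^ k)⁻¹ ∂eigenvalueDistribution (X ω)),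
      ← integral_complex_ofReal]
    simp
  have hlim : ∀ ω, Tendsto
      (fun k : ℕ => ∫ t : ℝ, (1 + k * q t ^ k)⁻¹ ∂eigenvalueDistribution (X ω)) atTop
      (𝓝 ((eigenvalueDistribution (X ω)).real (Set.Ioo a b))) := by
    intro ω
    rw [← integral_indicator_one measurableSet_Ioo]
    refine tendsto_integral_of_dominated_convergence (fun _ => 1)
      (fun k => Measurable.aestronglyMeasurable (by fun_prop)) (integrable_const _)
      (fun k => Eventually.of_forall fun t => ?_) (Eventually.of_forall fun t => ?_)
    · rw [norm_inv, Real.norm_of_nonneg (hpos k t).le]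
      refine inv_le_one_of_one_le₀ ?_
      have := hq0 t
      have : 0 ≤ (k : ℝ) * q t ^ k := by positivity
      linarith
    · have h1 := tendsto_inv_one_add_mul_pow_indicator (q t) (hq0 t)
      have h2 : (Set.Iio (1 : ℝ)).indicator (1 : ℝ → ℝ) (q t)
          = (Set.Ioo a b).indicator (1 : ℝ → ℝ) t := by
        have : q t ∈ Set.Iio 1 ↔ t ∈ Set.Ioo a b := by
          simp only [hqdef, Set.mem_Iio, Set.mem_Ioo, sq_lt_one_iff_abs_lt_one, abs_lt,
            lt_div_iff₀ hρ0, div_lt_iff₀ hρ0]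
          constructor <;> rintro ⟨h1, h2⟩ <;> constructor <;> linarith
        simp only [Set.indicator_apply, this, Pi.one_apply]
      rwa [h2] at h1
  have h := (measurable_of_tendsto_metrizable hmeas (tendsto_pi_nhds.2 hlim)).ennreal_ofReal
  convert h using 1
  funext ω
  rw [ofReal_measureReal]

omit [DecidableEq ι] in
/-- The eigenvalue distribution depends measurably on the matrix, so that the averaged distribution
is not a junk value of `Measure.bind`. -/
theorem measurable_eigenvalueDistribution (hX : ∀ i j, Measurable fun ω => X ω i j) :
    Measurable fun ω => eigenvalueDistribution (X ω) := by
  refine Measurable.measure_of_isPiSystem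
    (BorelSpace.measurable_eq.trans Real.borel_eq_generateFrom_Ioo_rat) Real.isPiSystem_Ioo_rat
    ?_ ?_
  · intro s hs
    simp only [Set.mem_iUnion, Set.mem_singleton_iff] at hs
    obtain ⟨a, b, hab, rfl⟩ := hs
    exact measurable_eigenvalueDistribution_Ioo hX (by exact_mod_cast hab)
  · have h := measurable_integral_inv_eval_eigenvalueDistribution hX 1 (by simp)
    have h2 := (Complex.measurable_re.comp h).ennreal_ofReal
    convert h2 using 1
    funext ω
    simp

end Measurability

section Averaged

variable {Ω : Type*} [MeasurableSpace Ω] {P : Measure Ω} [IsProbabilityMeasure P]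
  {X : Ω → Matrix ι ι ℂ}

theorem isProbabilityMeasure_averagedEigenvalueDistribution [Nonempty ι]
    (hX : ∀ i j, Measurable fun ω => X ω i j) (hH : ∀ᵐ ω ∂P, (X ω).IsHermitian) :
    IsProbabilityMeasure (averagedEigenvalueDistribution P X) := by
  constructor
  rw [averagedEigenvalueDistribution,
    Measure.bind_apply MeasurableSet.univ (measurable_eigenvalueDistribution hX).aemeasurable]
  have : ∫⁻ ω, eigenvalueDistribution (X ω) Set.univ ∂P = ∫⁻ _, 1 ∂P := by
    refine lintegral_congr_ae (hH.mono fun ω hω => ?_)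
    exact (isProbabilityMeasure_eigenvalueDistribution hω).measure_univ
  rw [this]
  simp

/-- The Cauchy transform of the averaged eigenvalue distribution is the expectation of the
normalized trace of the resolvent. -/
theorem cauchyTransform_averagedEigenvalueDistribution [Nonempty ι] [DecidableEq ι]
    (hX : ∀ i j, Measurable fun ω => X ω i j) (hH : ∀ᵐ ω ∂P, (X ω).IsHermitian) {z : ℂ}
    (hz : z ∈ upperHalf) :
    cauchyTransform (averagedEigenvalueDistribution P X) z
      = ∫ ω, (Fintype.card ι : ℝ)⁻¹ • (resolventMatrix z (X ω)).trace ∂P := by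
  have := isProbabilityMeasure_averagedEigenvalueDistribution hX hH
  set κ : Kernel Ω ℝ :=
    ⟨fun ω => eigenvalueDistribution (X ω), measurable_eigenvalueDistribution hX⟩ with hκ
  have hbind : averagedEigenvalueDistribution P X = (κ ∘ₖ Kernel.const Unit P) () := by
    rw [← Measure.comp_eq_comp_const_apply]
    rfl
  have hint := integrable_inv_sub_ofReal_pow (averagedEigenvalueDistribution P X) hz 1
  rw [cauchyTransform_eq_integral_inv, hbind, Kernel.integral_comp (by rwa [← hbind])]
  simp only [Kernel.const_apply]
  refine integral_congr_ae (hH.mono fun ω hω => ?_)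
  have h1 : κ ω = eigenvalueDistribution (X ω) := rfl
  simp only [h1, pow_one]
  rw [integral_eigenvalueDistribution hω, trace_resolventMatrix hω hz]

end Averaged

end EigenvalueDistribution

/-! ### Integration by parts and concentration for Gaussian measures -/

section Gaussian

variable {E : Type*} [NormedAddCommGroup E] [NormedSpace ℝ E]

/-- The first component of a pair `(x, y)` rotated by the angle `θ`. If `x` and `y` are independent
copies of a centred Gaussian vector, then so are `rotFst θ (x, y)` and its derivative in `θ`. -/
noncomputable def rotFst (θ : ℝ) (p : E × E) : E := Real.cos θ • p.1 + Real.sin θ • p.2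

theorem rotFst_rotation (θ : ℝ) (p : E × E) :
    rotFst θ (ContinuousLinearMap.rotation θ p) = rotFst (2 * θ) p := by
  simp only [rotFst, ContinuousLinearMap.rotation_apply, Real.cos_two_mul', Real.sin_two_mul]
  module

theorem sin_smul_fst_add_cos_smul_snd_rotation (θ : ℝ) (p : E × E) :
    Real.sin θ • (ContinuousLinearMap.rotation θ p).1
      + Real.cos θ • (ContinuousLinearMap.rotation θ p).2 = p.2 := by
  simp only [ContinuousLinearMap.rotation_apply]
  have h := Real.sin_sq_add_cos_sq θ
  have h2 : Real.sin θ • (Real.cos θ • p.1 + Real.sin θ • p.2)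
      + Real.cos θ • (-Real.sin θ • p.1 + Real.cos θ • p.2)
      = (Real.sin θ ^ 2 + Real.cos θ ^ 2) • p.2 := by module
  rw [h2, h, one_smul]

@[simp] theorem rotFst_zero (p : E × E) : rotFst 0 p = p.1 := by simp [rotFst]

@[simp] theorem rotFst_pi_div_two (p : E × E) : rotFst (Real.pi / 2) p = p.2 := by simp [rotFst]

theorem norm_slope_rotFst_le {F : E → ℂ} {C : ℝ} {p : E × E}
    (h : ∀ θ : ℝ, ‖F (rotFst θ p) - F p.1‖ ≤ C * |θ| * (‖p.1‖ + ‖p.2‖)) {θ : ℝ} (hθ : θ ≠ 0) :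
    ‖θ⁻¹ • (F (rotFst θ p) - F p.1)‖ ≤ C * (‖p.1‖ + ‖p.2‖) := by
  rw [norm_smul, norm_inv, Real.norm_eq_abs, inv_mul_le_iff₀ (abs_pos.2 hθ)]
  linarith [h θ]

variable [MeasurableSpace E] [BorelSpace E] [SecondCountableTopology E]

/-- `F` has, for almost all `(x, y)`, the derivative `D (x, y)` at `θ = 0` along the rotation
`θ ↦ cos θ • x + sin θ • y`, and is Lipschitz along it. For a smooth function `F` this derivative is
`DF(x)[y]`. -/
structure HasRotationDeriv (γ : Measure E) (F : E → ℂ) (D : E × E → ℂ) (C : ℝ) : Prop where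
  measurable : Measurable F
  measurable_deriv : Measurable D
  hasDerivAt : ∀ᵐ p ∂γ.prod γ, HasDerivAt (fun θ => F (rotFst θ p)) (D p) 0
  lipschitz : ∀ᵐ p ∂γ.prod γ, ∀ θ : ℝ, ‖F (rotFst θ p) - F p.1‖ ≤ C * |θ| * (‖p.1‖ + ‖p.2‖)

theorem measurable_rotFst (θ : ℝ) : Measurable (rotFst θ : E × E → E) := by
  unfold rotFst; fun_prop

omit [BorelSpace E] [SecondCountableTopology E] in
theorem HasRotationDeriv.ae_tendsto_slope {γ : Measure E} {F : E → ℂ} {D : E × E → ℂ} {C : ℝ}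
    (h : HasRotationDeriv γ F D C) :
    ∀ᵐ p ∂γ.prod γ, Tendsto (fun θ : ℝ => θ⁻¹ • (F (rotFst θ p) - F p.1)) (𝓝[≠] 0) (𝓝 (D p)) := by
  filter_upwards [h.hasDerivAt] with p hp
  simpa using hp.tendsto_slope_zero

variable [CompleteSpace E] (γ : Measure E) [IsGaussian γ]

theorem measurePreserving_rotation (h0 : ∫ x, x ∂γ = 0) (θ : ℝ) :
    MeasurePreserving (ContinuousLinearMap.rotation (E := E) θ) (γ.prod γ) (γ.prod γ) :=
  ⟨by fun_prop, IsGaussian.map_rotation_eq_self (by simpa using h0) θ⟩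

theorem integral_comp_rotation (h0 : ∫ x, x ∂γ = 0) (θ : ℝ) {G : Type*} [NormedAddCommGroup G]
    [NormedSpace ℝ G] {f : E × E → G} (hf : AEStronglyMeasurable f (γ.prod γ)) :
    ∫ p, f (ContinuousLinearMap.rotation θ p) ∂γ.prod γ = ∫ p, f p ∂γ.prod γ := by
  have h := measurePreserving_rotation γ h0 θ
  conv_rhs => rw [← h.map_eq]
  exact (integral_map h.measurable.aemeasurable (by rwa [h.map_eq])).symm

theorem integrable_sq_norm_add_norm :
    Integrable (fun p : E × E => (‖p.1‖ + ‖p.2‖) ^ 2) (γ.prod γ) := by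
  have h1 : Integrable (fun x : E => ‖x‖ ^ 2) γ :=
    (IsGaussian.memLp_two_id (μ := γ)).integrable_norm_pow (by norm_num)
  have h2 : Integrable (fun p : E × E => 2 * ‖p.1‖ ^ 2 + 2 * ‖p.2‖ ^ 2) (γ.prod γ) :=
    ((h1.comp_fst γ).const_mul 2).add ((h1.comp_snd γ).const_mul 2)
  refine h2.mono' (Measurable.aestronglyMeasurable (by fun_prop)) (Eventually.of_forall fun p => ?_)
  rw [Real.norm_of_nonneg (by positivity)]
  nlinarith [sq_nonneg (‖p.1‖ - ‖p.2‖)]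

variable {F : E → ℂ} {D : E × E → ℂ} {C B : ℝ}

/-- **Gaussian integration by parts** (Stein's lemma), for a possibly degenerate Gaussian measure:
`E[ℓ(x) F(x)] = E[ℓ(y) DF(x)[y]]` with `y` an independent copy of `x`. By rotation invariance
`E[ℓ(y) F(cos θ x + sin θ y)] = sin θ E[ℓ(x) F(x)]`; take the derivative at `θ = 0`. -/
theorem integral_mul_eq_integral_deriv (h0 : ∫ x, x ∂γ = 0) (hF : HasRotationDeriv γ F D C)
    (hB : ∀ᵐ x ∂γ, ‖F x‖ ≤ B) (ℓ : E →L[ℝ] ℂ) :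
    ∫ x, ℓ x * F x ∂γ = ∫ p, ℓ p.2 * D p ∂γ.prod γ := by
  have hℓ : Integrable (fun x => ℓ x) γ :=
    ℓ.integrable_comp (IsGaussian.integrable_id (μ := γ))
  have hℓm : Measurable fun x => ℓ x := by fun_prop
  have hFm := hF.measurable
  have hFi : Integrable F γ := Integrable.of_bound hFm.aestronglyMeasurable B hB
  have hℓF : Integrable (fun x => ℓ x * F x) γ := hℓ.mul_bdd hFm.aestronglyMeasurable hB
  have hℓ0 : ∫ x, ℓ x ∂γ = 0 := by
    have := ℓ.integral_comp_comm (IsGaussian.integrable_id (μ := γ))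
    simpa [h0] using this
  have hrot : ∀ θ : ℝ, Integrable (fun p : E × E => ℓ p.2 * F (rotFst θ p)) (γ.prod γ) ∧
      ∫ p, ℓ p.2 * F (rotFst θ p) ∂γ.prod γ = (Real.sin θ : ℂ) * ∫ x, ℓ x * F x ∂γ := by
    intro θ
    set g : E × E → ℂ := fun q => ℓ (Real.sin θ • q.1 + Real.cos θ • q.2) * F q.1 with hg
    have hg1 : Integrable (fun q : E × E => (Real.sin θ : ℂ) * (ℓ q.1 * F q.1)) (γ.prod γ) :=
      (hℓF.comp_fst γ).const_mul _
    have hg2 : Integrable (fun q : E × E => (Real.cos θ : ℂ) * (F q.1 * ℓ q.2)) (γ.prod γ) :=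
      (hFi.mul_prod hℓ).const_mul _
    have hgeq : g = fun q => (Real.sin θ : ℂ) * (ℓ q.1 * F q.1)
        + (Real.cos θ : ℂ) * (F q.1 * ℓ q.2) := by
      funext q
      simp only [hg, map_add, map_smul, Complex.real_smul]
      ring
    have hgi : Integrable g (γ.prod γ) := hgeq ▸ hg1.add hg2
    have hgr : ∀ p, g (ContinuousLinearMap.rotation θ p) = ℓ p.2 * F (rotFst θ p) := by
      intro p
      simp only [hg, sin_smul_fst_add_cos_smul_snd_rotation]
      rfl
    constructor
    · simpa only [Function.comp_def, hgr] using
        (measurePreserving_rotation γ h0 θ).integrable_comp_of_integrable hgi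
    · have h1 := integral_comp_rotation γ h0 θ hgi.aestronglyMeasurable
      simp only [hgr] at h1
      rw [h1, hgeq, integral_add hg1 hg2, integral_const_mul, integral_const_mul,
        integral_prod_mul, hℓ0, integral_fun_fst fun x => ℓ x * F x]
      simp
  -- At `θ = 0` the integral vanishes, so `hrot` computes the integrals of the difference quotients.
  have hslope : ∀ θ : ℝ, ∫ p, ℓ p.2 * (θ⁻¹ • (F (rotFst θ p) - F p.1)) ∂γ.prod γ
      = ((Real.sin θ / θ : ℝ) : ℂ) * ∫ x, ℓ x * F x ∂γ := by
    intro θ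
    have h1 : ∀ p : E × E, ℓ p.2 * (θ⁻¹ • (F (rotFst θ p) - F p.1))
        = (θ : ℂ)⁻¹ * (ℓ p.2 * F (rotFst θ p) - ℓ p.2 * F (rotFst 0 p)) := by
      intro p
      rw [Complex.real_smul, rotFst_zero]
      push_cast
      ring
    simp_rw [h1]
    rw [integral_const_mul, integral_sub (hrot θ).1 (hrot 0).1, (hrot θ).2, (hrot 0).2]
    push_cast
    simp
    ring
  have hl1 : Tendsto (fun θ : ℝ => ((Real.sin θ / θ : ℝ) : ℂ) * ∫ x, ℓ x * F x ∂γ) (𝓝[≠] 0)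
      (𝓝 (∫ x, ℓ x * F x ∂γ)) := by
    have h1 : Tendsto (fun θ : ℝ => Real.sin θ / θ) (𝓝[≠] 0) (𝓝 1) := by
      have := (Real.hasDerivAt_sin 0).tendsto_slope_zero
      simpa [div_eq_inv_mul] using this
    have h2 := ((Complex.continuous_ofReal.tendsto 1).comp h1).mul_const (∫ x, ℓ x * F x ∂γ)
    simpa [Function.comp_def] using h2
  have hl2 : Tendsto (fun θ : ℝ => ∫ p, ℓ p.2 * (θ⁻¹ • (F (rotFst θ p) - F p.1)) ∂γ.prod γ)
      (𝓝[≠] 0) (𝓝 (∫ p, ℓ p.2 * D p ∂γ.prod γ)) := by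
    refine tendsto_integral_filter_of_dominated_convergence
      (fun p => ‖ℓ‖ * |C| * (‖p.1‖ + ‖p.2‖) ^ 2) ?_ ?_
      ((integrable_sq_norm_add_norm γ).const_mul _) ?_
    · refine Eventually.of_forall fun θ => Measurable.aestronglyMeasurable ?_
      have := hFm.comp (measurable_rotFst (E := E) θ)
      have h3 : Measurable fun p : E × E => θ⁻¹ • (F (rotFst θ p) - F p.1) :=
        (this.sub (hFm.comp measurable_fst)).const_smul θ⁻¹
      exact (hℓm.comp measurable_snd).mul h3
    · filter_upwards [self_mem_nhdsWithin] with θ hθ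
      filter_upwards [hF.lipschitz] with p hp
      rw [norm_mul]
      have h1 := norm_slope_rotFst_le hp hθ
      have h2 : C * (‖p.1‖ + ‖p.2‖) ≤ |C| * (‖p.1‖ + ‖p.2‖) := by
        gcongr; exact le_abs_self C
      have h3 : ‖ℓ p.2‖ ≤ ‖ℓ‖ * (‖p.1‖ + ‖p.2‖) :=
        (ℓ.le_opNorm _).trans (by gcongr; linarith [norm_nonneg p.1])
      calc ‖ℓ p.2‖ * ‖θ⁻¹ • (F (rotFst θ p) - F p.1)‖
          ≤ (‖ℓ‖ * (‖p.1‖ + ‖p.2‖)) * (|C| * (‖p.1‖ + ‖p.2‖)) := by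
            gcongr; exact h1.trans h2
        _ = _ := by ring
    · filter_upwards [hF.ae_tendsto_slope] with p hp using hp.const_mul _
  simp_rw [hslope] at hl2
  exact tendsto_nhds_unique hl1 hl2

/-- A **Poincaré inequality** for Gaussian measures, with `2 Var F` written as `E|F(y) - F(x)|²` for
independent copies `x`, `y`. The quantity `u θ = E|F(cos θ x + sin θ y) - F(x)|²` satisfies
`u (2θ) ≤ 4 u θ` by rotation invariance, and `u θ / θ² → E|DF(x)[y]|²` as `θ → 0`. -/
theorem integral_norm_sub_sq_le (h0 : ∫ x, x ∂γ = 0) (hF : HasRotationDeriv γ F D C) :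
    ∫ p : E × E, ‖F p.2 - F p.1‖ ^ 2 ∂γ.prod γ
      ≤ (Real.pi / 2) ^ 2 * ∫ p, ‖D p‖ ^ 2 ∂γ.prod γ := by
  have hFm := hF.measurable
  set u : ℝ → ℝ := fun θ => ∫ p : E × E, ‖F (rotFst θ p) - F p.1‖ ^ 2 ∂γ.prod γ with hu
  have hmeas : ∀ θ, Measurable fun p : E × E => F (rotFst θ p) - F p.1 := fun θ =>
    (hFm.comp (measurable_rotFst θ)).sub (hFm.comp measurable_fst)
  have hint : ∀ θ, Integrable (fun p : E × E => ‖F (rotFst θ p) - F p.1‖ ^ 2) (γ.prod γ) := by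
    intro θ
    refine ((integrable_sq_norm_add_norm γ).const_mul ((C * |θ|) ^ 2)).mono'
      ((hmeas θ).norm.pow_const 2).aestronglyMeasurable ?_
    filter_upwards [hF.lipschitz] with p hp
    rw [Real.norm_of_nonneg (by positivity), ← mul_pow]
    exact pow_le_pow_left₀ (norm_nonneg _) (hp θ) 2
  have hdouble : ∀ θ, u (2 * θ) ≤ 4 * u θ := by
    intro θ
    have hi := hint θ
    have hi2 := (measurePreserving_rotation γ h0 θ).integrable_comp_of_integrable hi
    have heq := integral_comp_rotation γ h0 θ hi.aestronglyMeasurable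
    simp only [Function.comp_def, rotFst_rotation] at hi2 heq
    have hfst : ∀ p : E × E, (ContinuousLinearMap.rotation θ p).1 = rotFst θ p := fun p => rfl
    simp only [hfst] at hi2 heq
    calc u (2 * θ) ≤ ∫ p : E × E, (2 * ‖F (rotFst (2 * θ) p) - F (rotFst θ p)‖ ^ 2
          + 2 * ‖F (rotFst θ p) - F p.1‖ ^ 2) ∂γ.prod γ := by
          refine integral_mono (hint _) ((hi2.const_mul 2).add (hi.const_mul 2)) fun p => ?_
          have h1 : ‖F (rotFst (2 * θ) p) - F p.1‖ ≤
              ‖F (rotFst (2 * θ) p) - F (rotFst θ p)‖ + ‖F (rotFst θ p) - F p.1‖ :=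
            norm_sub_le_norm_sub_add_norm_sub _ _ _
          have h2 := pow_le_pow_left₀ (norm_nonneg _) h1 2
          refine h2.trans ?_
          nlinarith [sq_nonneg (‖F (rotFst (2 * θ) p) - F (rotFst θ p)‖
            - ‖F (rotFst θ p) - F p.1‖)]
      _ = 4 * u θ := by
          rw [integral_add (hi2.const_mul 2) (hi.const_mul 2), integral_const_mul,
            integral_const_mul, heq]
          simp only [hu]
          ring
  -- The rotation by `π / 2` replaces `x` by the independent copy `y`.
  have hiter : ∀ k : ℕ, u (Real.pi / 2) ≤ 4 ^ k * u (Real.pi / 2 / 2 ^ k) := by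
    intro k
    induction k with
    | zero => simp
    | succ k ih =>
      have h1 := hdouble (Real.pi / 2 / 2 ^ (k + 1))
      have h2 : 2 * (Real.pi / 2 / 2 ^ (k + 1)) = Real.pi / 2 / 2 ^ k := by
        rw [pow_succ]; field_simp
      rw [h2] at h1
      calc _ ≤ _ := ih
        _ ≤ 4 ^ k * (4 * u (Real.pi / 2 / 2 ^ (k + 1))) := by gcongr
        _ = _ := by ring
  have hlim : Tendsto (fun θ : ℝ => ∫ p, ‖θ⁻¹ • (F (rotFst θ p) - F p.1)‖ ^ 2 ∂γ.prod γ) (𝓝[≠] 0)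
      (𝓝 (∫ p, ‖D p‖ ^ 2 ∂γ.prod γ)) := by
    refine tendsto_integral_filter_of_dominated_convergence
      (fun p => C ^ 2 * (‖p.1‖ + ‖p.2‖) ^ 2) ?_ ?_
      ((integrable_sq_norm_add_norm γ).const_mul _) ?_
    · exact Eventually.of_forall fun θ =>
        (((hmeas θ).const_smul θ⁻¹).norm.pow_const 2).aestronglyMeasurable
    · filter_upwards [self_mem_nhdsWithin] with θ hθ
      filter_upwards [hF.lipschitz] with p hp
      rw [Real.norm_of_nonneg (by positivity), ← mul_pow]
      exact pow_le_pow_left₀ (norm_nonneg _) (norm_slope_rotFst_le hp hθ) 2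
    · filter_upwards [hF.ae_tendsto_slope] with p hp using hp.norm.pow 2
  have hseq : Tendsto (fun k : ℕ => Real.pi / 2 / 2 ^ k) atTop (𝓝[≠] 0) := by
    refine tendsto_nhdsWithin_iff.2 ⟨?_, Eventually.of_forall fun k => ?_⟩
    · exact tendsto_const_nhds.div_atTop (tendsto_pow_atTop_atTop_of_one_lt (by norm_num))
    · have := Real.pi_pos
      exact (by positivity : Real.pi / 2 / 2 ^ k ≠ 0)
  have hlim2 := (hlim.comp hseq).const_mul ((Real.pi / 2) ^ 2)
  have hgoal : u (Real.pi / 2) ≤ (Real.pi / 2) ^ 2 * ∫ p, ‖D p‖ ^ 2 ∂γ.prod γ := by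
    refine ge_of_tendsto hlim2 (Eventually.of_forall fun k => (hiter k).trans_eq ?_)
    have hpi := Real.pi_pos
    simp only [Function.comp_apply, norm_smul, mul_pow, hu]
    rw [integral_const_mul, ← mul_assoc]
    congr 1
    rw [norm_inv, inv_pow, Real.norm_of_nonneg (by positivity), div_pow (Real.pi / 2), ← pow_mul,
      mul_comm k 2, pow_mul]
    norm_num
    field_simp
  simpa only [hu, rotFst_pi_div_two] using hgoal

end Gaussian

/-! ### Resolvents of Gaussian selfadjoint matrices -/

section RandomMatrix

open scoped Matrix.Norms.L2Operator

variable {ι : Type*} [Fintype ι] [DecidableEq ι]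

omit [DecidableEq ι] in
theorem isHermitian_rotFst {p : (ι → ι → ℂ) × (ι → ι → ℂ)} (h₁ : (Matrix.of p.1).IsHermitian)
    (h₂ : (Matrix.of p.2).IsHermitian) (θ : ℝ) : (Matrix.of (rotFst θ p)).IsHermitian := by
  have h : Matrix.of (rotFst θ p) = Real.cos θ • Matrix.of p.1 + Real.sin θ • Matrix.of p.2 := rfl
  rw [h, Matrix.IsHermitian, Matrix.conjTranspose_add, Matrix.conjTranspose_smul,
    Matrix.conjTranspose_smul, h₁.eq, h₂.eq]
  simp

theorem exists_norm_of_le :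
    ∃ K : ℝ, 0 ≤ K ∧ ∀ x : ι → ι → ℂ, ‖Matrix.of x‖ ≤ K * ‖x‖ := by
  set L := LinearMap.toContinuousLinearMap
    ((Matrix.ofLinearEquiv ℂ : (ι → ι → ℂ) ≃ₗ[ℂ] Matrix ι ι ℂ).toLinearMap)
  exact ⟨‖L‖, norm_nonneg _, fun x => L.le_opNorm x⟩

theorem norm_trace_mul_le (T M : Matrix ι ι ℂ) :
    ‖(T * M).trace‖ ≤ (∑ i, ∑ j, ‖T i j‖) * ‖M‖ := by
  simp only [Matrix.trace, Matrix.diag_apply, Matrix.mul_apply]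
  rw [Finset.sum_mul]
  refine (norm_sum_le _ _).trans (Finset.sum_le_sum fun i _ => ?_)
  rw [Finset.sum_mul]
  refine (norm_sum_le _ _).trans (Finset.sum_le_sum fun j _ => ?_)
  rw [norm_mul]
  gcongr
  exact norm_entry_le_l2_opNorm M j i

theorem norm_rotFst_sub_le (p : (ι → ι → ℂ) × (ι → ι → ℂ)) (θ : ℝ) :
    ‖Matrix.of (rotFst θ p) - Matrix.of p.1‖ ≤ |θ| * (‖Matrix.of p.1‖ + ‖Matrix.of p.2‖) := by
  have h : Matrix.of (rotFst θ p) - Matrix.of p.1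
      = (Real.cos θ - 1) • Matrix.of p.1 + Real.sin θ • Matrix.of p.2 := by
    have h1 : Matrix.of (rotFst θ p)
      = Real.cos θ • Matrix.of p.1 + Real.sin θ • Matrix.of p.2 := rfl
    rw [h1]; module
  rw [h, mul_add]
  refine (norm_add_le _ _).trans ?_
  rw [norm_smul, norm_smul]
  have h1 : |Real.cos θ - 1| ≤ |θ| := by
    have := Real.abs_cos_sub_cos_le θ 0
    simpa using this
  have h2 : |Real.sin θ| ≤ |θ| := Real.abs_sin_le_abs
  gcongr <;> assumption

theorem norm_resolventMatrix_sub_le {X Y : Matrix ι ι ℂ} (hX : X.IsHermitian) (hY : Y.IsHermitian)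
    {z : ℂ} (hz : z ∈ upperHalf) :
    ‖resolventMatrix z Y - resolventMatrix z X‖ ≤ (1 / z.im) ^ 2 * ‖Y - X‖ := by
  have hz' : 0 < z.im := hz
  rw [resolventMatrix_sub hX hY hz hz, sub_self, zero_smul, sub_zero]
  calc _ ≤ ‖resolventMatrix z Y‖ * ‖Y - X‖ * ‖resolventMatrix z X‖ :=
        (norm_mul_le _ _).trans (by gcongr; exact norm_mul_le _ _)
    _ ≤ (1 / z.im) * ‖Y - X‖ * (1 / z.im) := by
        gcongr
        · exact norm_resolventMatrix_le hY hz
        · exact norm_resolventMatrix_le hX hz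
    _ = _ := by ring

/-- The derivative of the resolvent along a rotation is `R Y R`. -/
theorem hasDerivAt_resolventMatrix_rotFst {p : (ι → ι → ℂ) × (ι → ι → ℂ)}
    (h₁ : (Matrix.of p.1).IsHermitian) (h₂ : (Matrix.of p.2).IsHermitian) {z : ℂ}
    (hz : z ∈ upperHalf) :
    HasDerivAt (fun θ : ℝ => resolventMatrix z (Matrix.of (rotFst θ p)))
      (resolventMatrix z (Matrix.of p.1) * Matrix.of p.2 * resolventMatrix z (Matrix.of p.1))
      0 := by
  rw [hasDerivAt_iff_tendsto_slope_zero]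
  have hslope : ∀ t : ℝ, t⁻¹ • (resolventMatrix z (Matrix.of (rotFst (0 + t) p))
      - resolventMatrix z (Matrix.of (rotFst 0 p)))
      = resolventMatrix z (Matrix.of (rotFst t p)) *
        (((t⁻¹ * (Real.cos t - 1)) • Matrix.of p.1 + (t⁻¹ * Real.sin t) • Matrix.of p.2)) *
          resolventMatrix z (Matrix.of p.1) := by
    intro t
    have h : Matrix.of (rotFst t p) - Matrix.of p.1
        = (Real.cos t - 1) • Matrix.of p.1 + Real.sin t • Matrix.of p.2 := by
      have h1 : Matrix.of (rotFst t p)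
        = Real.cos t • Matrix.of p.1 + Real.sin t • Matrix.of p.2 := rfl
      rw [h1]; module
    rw [zero_add, rotFst_zero, resolventMatrix_sub h₁ (isHermitian_rotFst h₁ h₂ t) hz hz, sub_self,
      zero_smul, sub_zero, h, ← smul_smul, ← smul_smul, ← smul_add, mul_smul_comm, smul_mul_assoc]
  simp only [hslope]
  have hsin : Tendsto (fun t : ℝ => t⁻¹ * Real.sin t) (𝓝[≠] 0) (𝓝 1) := by
    simpa using (Real.hasDerivAt_sin 0).tendsto_slope_zero
  have hcos : Tendsto (fun t : ℝ => t⁻¹ * (Real.cos t - 1)) (𝓝[≠] 0) (𝓝 0) := by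
    simpa using (Real.hasDerivAt_cos 0).tendsto_slope_zero
  have hR : Tendsto (fun t : ℝ => resolventMatrix z (Matrix.of (rotFst t p))) (𝓝[≠] 0)
      (𝓝 (resolventMatrix z (Matrix.of p.1))) := by
    refine Tendsto.mono_left ?_ nhdsWithin_le_nhds
    rw [tendsto_iff_norm_sub_tendsto_zero]
    have hle : ∀ t : ℝ, ‖resolventMatrix z (Matrix.of (rotFst t p))
        - resolventMatrix z (Matrix.of p.1)‖
        ≤ (1 / z.im) ^ 2 * (|t| * (‖Matrix.of p.1‖ + ‖Matrix.of p.2‖)) := fun t =>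
      (norm_resolventMatrix_sub_le h₁ (isHermitian_rotFst h₁ h₂ t) hz).trans
        (mul_le_mul_of_nonneg_left (norm_rotFst_sub_le p t) (by positivity))
    refine squeeze_zero (fun t => norm_nonneg _) hle ?_
    have hc : Continuous fun t : ℝ =>
        (1 / z.im) ^ 2 * (|t| * (‖Matrix.of p.1‖ + ‖Matrix.of p.2‖)) := by
      fun_prop
    simpa using hc.tendsto 0
  have := (hR.mul ((hcos.smul_const (Matrix.of p.1)).add
    (hsin.smul_const (Matrix.of p.2)))).mul_const (resolventMatrix z (Matrix.of p.1))
  simpa using this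

variable {γ : Measure (ι → ι → ℂ)}

theorem measurable_resolventMatrix_of_entry (z : ℂ) (a b : ι) :
    Measurable fun x : ι → ι → ℂ => resolventMatrix z (Matrix.of x) a b :=
  measurable_resolventMatrix_entry (X := fun x : ι → ι → ℂ => Matrix.of x)
    (fun i j => by simp only [Matrix.of_apply]; fun_prop) z a b

theorem measurable_trace_mul_resolventMatrix (T : Matrix ι ι ℂ) (z : ℂ) :
    Measurable fun x : ι → ι → ℂ => (T * resolventMatrix z (Matrix.of x)).trace := by
  have hm := measurable_resolventMatrix_of_entry (ι := ι) z
  simp only [Matrix.trace, Matrix.diag_apply, Matrix.mul_apply]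
  fun_prop

theorem hasRotationDeriv_trace_mul_resolventMatrix [SFinite γ]
    (hH : ∀ᵐ x ∂γ, (Matrix.of x).IsHermitian) (T : Matrix ι ι ℂ) {z : ℂ} (hz : z ∈ upperHalf) :
    ∃ C, HasRotationDeriv γ (fun x => (T * resolventMatrix z (Matrix.of x)).trace)
      (fun p => (T * (resolventMatrix z (Matrix.of p.1) * Matrix.of p.2
        * resolventMatrix z (Matrix.of p.1))).trace) C := by
  obtain ⟨K, hK0, hK⟩ := exists_norm_of_le (ι := ι)
  have hH2 : ∀ᵐ p ∂γ.prod γ, (Matrix.of p.1).IsHermitian ∧ (Matrix.of p.2).IsHermitian :=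
    (Measure.quasiMeasurePreserving_fst.ae hH).and (Measure.quasiMeasurePreserving_snd.ae hH)
  refine ⟨(∑ i, ∑ j, ‖T i j‖) * (1 / z.im) ^ 2 * K,
    measurable_trace_mul_resolventMatrix T z, ?_, ?_, ?_⟩
  · have hm : ∀ i j, Measurable fun p : (ι → ι → ℂ) × (ι → ι → ℂ) =>
        resolventMatrix z (Matrix.of p.1) i j := fun i j =>
      (measurable_resolventMatrix_of_entry z i j).comp measurable_fst
    simp only [Matrix.trace, Matrix.diag_apply, Matrix.mul_apply, Matrix.of_apply]
    fun_prop
  · filter_upwards [hH2] with p hp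
    have hd := hasDerivAt_resolventMatrix_rotFst hp.1 hp.2 hz
    set L : Matrix ι ι ℂ →L[ℝ] ℂ := LinearMap.toContinuousLinearMap
      ((Matrix.traceLinearMap ι ℝ ℂ).comp (LinearMap.mulLeft ℝ T)) with hL
    exact L.hasFDerivAt.comp_hasDerivAt (0 : ℝ) hd
  · filter_upwards [hH2] with p hp θ
    rw [← Matrix.trace_sub, ← Matrix.mul_sub]
    have h1 := norm_resolventMatrix_sub_le hp.1 (isHermitian_rotFst hp.1 hp.2 θ) hz
    have h2 := norm_rotFst_sub_le p θ
    calc _ ≤ (∑ i, ∑ j, ‖T i j‖) * ‖resolventMatrix z (Matrix.of (rotFst θ p))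
          - resolventMatrix z (Matrix.of p.1)‖ := norm_trace_mul_le _ _
      _ ≤ (∑ i, ∑ j, ‖T i j‖) * ((1 / z.im) ^ 2 * (|θ| * (K * ‖p.1‖ + K * ‖p.2‖))) := by
        gcongr
        refine h1.trans ?_
        gcongr
        refine h2.trans ?_
        gcongr
        · exact hK _
        · exact hK _
      _ = _ := by ring

theorem ae_norm_trace_mul_resolventMatrix_le (hH : ∀ᵐ x ∂γ, (Matrix.of x).IsHermitian)
    (T : Matrix ι ι ℂ) {z : ℂ} (hz : z ∈ upperHalf) :
    ∀ᵐ x ∂γ, ‖(T * resolventMatrix z (Matrix.of x)).trace‖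
      ≤ (∑ i, ∑ j, ‖T i j‖) * (1 / z.im) := by
  filter_upwards [hH] with x hx
  refine (norm_trace_mul_le _ _).trans ?_
  gcongr
  exact norm_resolventMatrix_le hx hz

theorem ae_norm_resolventMatrix_entry_le (hH : ∀ᵐ x ∂γ, (Matrix.of x).IsHermitian) {z : ℂ}
    (hz : z ∈ upperHalf) (a b : ι) :
    ∀ᵐ x ∂γ, ‖resolventMatrix z (Matrix.of x) a b‖ ≤ 1 / z.im := by
  filter_upwards [hH] with x hx
  exact (norm_entry_le_l2_opNorm _ _ _).trans (norm_resolventMatrix_le hx hz)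

theorem integrable_resolventMatrix_entry [IsFiniteMeasure γ]
    (hH : ∀ᵐ x ∂γ, (Matrix.of x).IsHermitian) {z : ℂ} (hz : z ∈ upperHalf) (a b : ι) :
    Integrable (fun x => resolventMatrix z (Matrix.of x) a b) γ :=
  Integrable.of_bound (measurable_resolventMatrix_of_entry z a b).aestronglyMeasurable _
    (ae_norm_resolventMatrix_entry_le hH hz a b)

variable [IsGaussian γ]

omit [DecidableEq ι] in
theorem memLp_two_entry (a b : ι) : MemLp (fun x : ι → ι → ℂ => x a b) 2 γ := by
  set L : (ι → ι → ℂ) →L[ℝ] ℂ :=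
    (ContinuousLinearMap.proj (R := ℝ) (φ := fun _ : ι => ℂ) b).comp
      (ContinuousLinearMap.proj (R := ℝ) (φ := fun _ : ι => ι → ℂ) a)
  exact L.comp_memLp' (IsGaussian.memLp_two_id (μ := γ))

/-- The **Schwinger-Dyson equation** for the expected resolvent of a centred Gaussian selfadjoint
matrix: integration by parts in `z R = 1 + X R`. -/
theorem integral_resolventMatrix_entry_eq (h0 : ∫ x, x ∂γ = 0)
    (hH : ∀ᵐ x ∂γ, (Matrix.of x).IsHermitian) {z : ℂ} (hz : z ∈ upperHalf) (a c : ι) :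
    z * ∫ x, resolventMatrix z (Matrix.of x) a c ∂γ = (1 : Matrix ι ι ℂ) a c +
      ∑ b, ∑ e, ∑ f, (∫ x, x a b * x e f ∂γ) *
        ∫ x, resolventMatrix z (Matrix.of x) b e * resolventMatrix z (Matrix.of x) f c ∂γ := by
  have hIBP : ∀ b, Integrable (fun x : ι → ι → ℂ => x a b * resolventMatrix z (Matrix.of x) b c) γ ∧
      ∫ x, x a b * resolventMatrix z (Matrix.of x) b c ∂γ =
      ∑ e, ∑ f, (∫ x, x a b * x e f ∂γ) *
        ∫ x, resolventMatrix z (Matrix.of x) b e * resolventMatrix z (Matrix.of x) f c ∂γ := by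
    intro b
    set L : (ι → ι → ℂ) →L[ℝ] ℂ :=
      (ContinuousLinearMap.proj (R := ℝ) (φ := fun _ : ι => ℂ) b).comp
      (ContinuousLinearMap.proj (R := ℝ) (φ := fun _ : ι => ι → ℂ) a)
      with hL
    have hLa : ∀ x, L x = x a b := fun x => rfl
    -- The entry `R b c` is the linear statistic `tr (T R)` for the matrix unit `T` at `(c, b)`.
    obtain ⟨C, hC⟩ := hasRotationDeriv_trace_mul_resolventMatrix hH (Matrix.single c b 1) hz
    have hS := integral_mul_eq_integral_deriv γ h0 hC
      (ae_norm_trace_mul_resolventMatrix_le hH (Matrix.single c b 1) hz) L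
    have htr : ∀ M : Matrix ι ι ℂ, (Matrix.single c b (1 : ℂ) * M).trace = M b c := by
      intro M
      simp [Matrix.trace_single_mul]
    simp only [htr, hLa] at hS
    refine ⟨(memLp_two_entry a b).integrable (by norm_num) |>.mul_bdd
      (measurable_resolventMatrix_of_entry z b c).aestronglyMeasurable
      (ae_norm_resolventMatrix_entry_le hH hz b c), ?_⟩
    rw [hS]
    have hexp : ∀ p : (ι → ι → ℂ) × (ι → ι → ℂ), p.2 a b *
        (resolventMatrix z (Matrix.of p.1) * Matrix.of p.2 * resolventMatrix z (Matrix.of p.1)) b c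
        = ∑ e, ∑ f, (resolventMatrix z (Matrix.of p.1) b e * resolventMatrix z (Matrix.of p.1) f c)
          * (p.2 a b * p.2 e f) := by
      intro p
      simp only [Matrix.mul_apply, Matrix.of_apply, Finset.sum_mul, Finset.mul_sum]
      rw [Finset.sum_comm]
      refine Finset.sum_congr rfl fun e _ => Finset.sum_congr rfl fun f _ => by ring
    simp only [hexp]
    have hint : ∀ e f, Integrable (fun p : (ι → ι → ℂ) × (ι → ι → ℂ) =>
        (resolventMatrix z (Matrix.of p.1) b e * resolventMatrix z (Matrix.of p.1) f c)
          * (p.2 a b * p.2 e f)) (γ.prod γ) := by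
      intro e f
      refine Integrable.mul_prod (f := fun x : ι → ι → ℂ =>
        resolventMatrix z (Matrix.of x) b e * resolventMatrix z (Matrix.of x) f c)
        (g := fun y : ι → ι → ℂ => y a b * y e f) ?_ ?_
      · exact (integrable_resolventMatrix_entry hH hz b e).mul_bdd
          (measurable_resolventMatrix_of_entry z f c).aestronglyMeasurable
          (ae_norm_resolventMatrix_entry_le hH hz f c)
      · exact (memLp_two_entry a b).integrable_mul (memLp_two_entry e f)
    rw [integral_finsetSum _ fun e _ => integrable_finsetSum _ fun f _ => hint e f]
    refine Finset.sum_congr rfl fun e _ => ?_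
    rw [integral_finsetSum _ fun f _ => hint e f]
    refine Finset.sum_congr rfl fun f _ => ?_
    rw [integral_prod_mul (fun x : ι → ι → ℂ =>
        resolventMatrix z (Matrix.of x) b e * resolventMatrix z (Matrix.of x) f c)
        (fun y : ι → ι → ℂ => y a b * y e f), mul_comm]
  have hpt : ∀ᵐ x ∂γ, z * resolventMatrix z (Matrix.of x) a c
      = (1 : Matrix ι ι ℂ) a c + ∑ b, x a b * resolventMatrix z (Matrix.of x) b c := by
    filter_upwards [hH] with x hx
    have h := congrFun (congrFun (sub_mul_resolventMatrix hx hz) a) c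
    rw [sub_mul, smul_mul_assoc, one_mul, Matrix.sub_apply, Matrix.smul_apply, smul_eq_mul,
      sub_eq_iff_eq_add] at h
    rw [h, Matrix.mul_apply]
    rfl
  rw [← integral_const_mul, integral_congr_ae hpt,
    integral_add (integrable_const _) (integrable_finsetSum _ fun b _ => (hIBP b).1),
    integral_finsetSum _ fun b _ => (hIBP b).1]
  simp only [integral_const, probReal_univ, one_smul]
  congr 1
  exact Finset.sum_congr rfl fun b _ => (hIBP b).2

/-- Concentration of linear statistics `tr (T R)` of the resolvent, if the covariance of the matrix
entries is bounded by `K` as a quadratic form. -/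
theorem integral_norm_trace_sub_sq_le (h0 : ∫ x, x ∂γ = 0)
    (hH : ∀ᵐ x ∂γ, (Matrix.of x).IsHermitian) {K : ℝ} (hK0 : 0 ≤ K)
    (hK : ∀ B : Matrix ι ι ℂ, ∫ y, ‖(Matrix.of y * B).trace‖ ^ 2 ∂γ ≤ K * ∑ i, ∑ j, ‖B i j‖ ^ 2)
    (T : Matrix ι ι ℂ) {z : ℂ} (hz : z ∈ upperHalf) :
    ∫ p, ‖(T * resolventMatrix z (Matrix.of p.2)).trace
        - (T * resolventMatrix z (Matrix.of p.1)).trace‖ ^ 2 ∂γ.prod γ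
      ≤ (Real.pi / 2) ^ 2 * (K * ((1 / z.im) ^ 4 * ∑ i, ∑ j, ‖T i j‖ ^ 2)) := by
  have hz' : 0 < z.im := hz
  obtain ⟨C, hC⟩ := hasRotationDeriv_trace_mul_resolventMatrix hH T hz
  refine (integral_norm_sub_sq_le γ h0 hC).trans ?_
  gcongr
  set D : (ι → ι → ℂ) × (ι → ι → ℂ) → ℂ := fun p => (T * (resolventMatrix z (Matrix.of p.1) *
    Matrix.of p.2 * resolventMatrix z (Matrix.of p.1))).trace with hD
  -- For fixed `x` the derivative is linear in `y`, so `hK` bounds its second moment.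
  have hcyc : ∀ p, D p = (Matrix.of p.2 * (resolventMatrix z (Matrix.of p.1) * T *
      resolventMatrix z (Matrix.of p.1))).trace := by
    intro p
    simp only [hD]
    rw [mul_assoc (resolventMatrix z (Matrix.of p.1)), ← mul_assoc T, Matrix.trace_mul_comm]
    simp only [mul_assoc]
  obtain ⟨K', hK'0, hK'⟩ := exists_norm_of_le (ι := ι)
  have hint : Integrable (fun p => ‖D p‖ ^ 2) (γ.prod γ) := by
    refine ((integrable_sq_norm_add_norm γ).const_mul
      (((∑ i, ∑ j, ‖T i j‖) * ((1 / z.im) * K' * (1 / z.im))) ^ 2)).mono'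
      (hC.measurable_deriv.norm.pow_const 2).aestronglyMeasurable ?_
    filter_upwards [Measure.quasiMeasurePreserving_fst.ae hH] with p hp
    rw [Real.norm_of_nonneg (by positivity), ← mul_pow]
    refine pow_le_pow_left₀ (norm_nonneg _) ?_ 2
    calc ‖D p‖ ≤ (∑ i, ∑ j, ‖T i j‖) * ‖resolventMatrix z (Matrix.of p.1) *
          Matrix.of p.2 * resolventMatrix z (Matrix.of p.1)‖ := norm_trace_mul_le _ _
      _ ≤ (∑ i, ∑ j, ‖T i j‖) * ((1 / z.im) * (K' * (‖p.1‖ + ‖p.2‖)) * (1 / z.im)) := by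
        gcongr
        refine (norm_mul_le _ _).trans ?_
        have hR := norm_resolventMatrix_le hp hz
        gcongr
        refine (norm_mul_le _ _).trans ?_
        gcongr
        refine (hK' _).trans ?_
        gcongr
        linarith [norm_nonneg p.1]
      _ = _ := by ring
  rw [integral_prod _ hint]
  have hbound : ∀ᵐ x ∂γ, ∫ y, ‖D (x, y)‖ ^ 2 ∂γ ≤ K * ((1 / z.im) ^ 4 * ∑ i, ∑ j, ‖T i j‖ ^ 2) := by
    filter_upwards [hH] with x hx
    simp only [hcyc]
    refine (hK _).trans ?_
    gcongr
    have hR := norm_resolventMatrix_le hx hz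
    calc _ ≤ ‖resolventMatrix z (Matrix.of x)‖ ^ 2 *
          ∑ i, ∑ j, ‖(resolventMatrix z (Matrix.of x) * T) i j‖ ^ 2 := sum_norm_sq_mul_le_right _ _
      _ ≤ ‖resolventMatrix z (Matrix.of x)‖ ^ 2 * (‖resolventMatrix z (Matrix.of x)‖ ^ 2 *
          ∑ i, ∑ j, ‖T i j‖ ^ 2) := by
        gcongr; exact sum_norm_sq_mul_le _ _
      _ ≤ (1 / z.im) ^ 2 * ((1 / z.im) ^ 2 * ∑ i, ∑ j, ‖T i j‖ ^ 2) := by gcongr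
      _ = _ := by ring
  refine (integral_mono_ae hint.integral_prod_left (integrable_const _) hbound).trans_eq ?_
  simp

omit [Fintype ι] [DecidableEq ι] in
/-- The covariance of two functions, bounded through independent copies. -/
theorem norm_integral_mul_sub_mul_le {Ω : Type*} [MeasurableSpace Ω] {P : Measure Ω}
    [IsProbabilityMeasure P] {f g : Ω → ℂ} (hf : MemLp f 2 P) (hg : MemLp g 2 P) :
    ‖∫ x, f x * g x ∂P - (∫ x, f x ∂P) * ∫ x, g x ∂P‖ ≤
      (∫ p, ‖f p.2 - f p.1‖ ^ 2 ∂P.prod P + ∫ p, ‖g p.2 - g p.1‖ ^ 2 ∂P.prod P) / 4 := by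
  have hf1 := hf.integrable (by norm_num)
  have hg1 := hg.integrable (by norm_num)
  have hfg : Integrable (fun x => f x * g x) P := hf.integrable_mul hg
  have key : ∫ p, (f p.2 - f p.1) * (g p.2 - g p.1) ∂P.prod P
      = 2 * (∫ x, f x * g x ∂P - (∫ x, f x ∂P) * ∫ x, g x ∂P) := by
    have h : ∀ p : Ω × Ω, (f p.2 - f p.1) * (g p.2 - g p.1)
        = (f p.2 * g p.2 + f p.1 * g p.1) - (f p.1 * g p.2 + g p.1 * f p.2) := fun p => by ring
    simp only [h]
    have hA : Integrable (fun p : Ω × Ω => f p.2 * g p.2 + f p.1 * g p.1) (P.prod P) :=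
      (hfg.comp_snd P).add (hfg.comp_fst P)
    have hB : Integrable (fun p : Ω × Ω => f p.1 * g p.2 + g p.1 * f p.2) (P.prod P) :=
      (hf1.mul_prod hg1).add (hg1.mul_prod hf1)
    rw [integral_sub hA hB,
      integral_add (hfg.comp_snd P) (hfg.comp_fst P),
      integral_add (hf1.mul_prod hg1) (hg1.mul_prod hf1), integral_prod_mul, integral_prod_mul,
      integral_fun_fst fun x => f x * g x, integral_fun_snd fun x => f x * g x]
    simp only [probReal_univ, one_smul]
    ring
  have hsq : ∀ {h : Ω → ℂ}, MemLp h 2 P →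
      Integrable (fun p : Ω × Ω => ‖h p.2 - h p.1‖ ^ 2) (P.prod P) := fun {h} hh =>
    ((hh.comp_snd P).sub (hh.comp_fst P)).integrable_norm_pow (by norm_num)
  have h2 : ‖∫ p, (f p.2 - f p.1) * (g p.2 - g p.1) ∂P.prod P‖ ≤
      ∫ p, (‖f p.2 - f p.1‖ ^ 2 + ‖g p.2 - g p.1‖ ^ 2) / 2 ∂P.prod P := by
    refine norm_integral_le_of_norm_le (((hsq hf).add (hsq hg)).div_const 2)
      (Eventually.of_forall fun p => ?_)
    rw [norm_mul]
    nlinarith [sq_nonneg (‖f p.2 - f p.1‖ - ‖g p.2 - g p.1‖)]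
  rw [key, integral_div, integral_add (hsq hf) (hsq hg), norm_mul] at h2
  simp only [Complex.norm_ofNat] at h2
  linarith

end RandomMatrix

/-! ### Gaussian block matrices and the partial trace -/

section BlockLaw

variable {d N : ℕ} {σ : Fin d → Fin d → Fin d → Fin d → ℂ}

/-- `γ` is the law, on arrays indexed by `Fin d × Fin N`, of a Gaussian selfadjoint block matrix
with covariance `σ`. -/
structure IsGaussianBlockLaw (σ : Fin d → Fin d → Fin d → Fin d → ℂ)
    (γ : Measure (Fin d × Fin N → Fin d × Fin N → ℂ)) : Prop where
  isGaussian : IsGaussian γ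
  integral_id : ∫ x, x ∂γ = 0
  isHermitian : ∀ᵐ x ∂γ, (Matrix.of x).IsHermitian
  covariance : ∀ a b c e, ∫ x, x a b * x c e ∂γ =
    if a.2 = e.2 ∧ b.2 = c.2 then σ a.1 b.1 c.1 e.1 / ((d * N : ℕ) : ℂ) else 0

/-- The array of the entries of a block matrix. -/
def blockArray {Ω : Type*} (a : Fin d → Fin d → Fin N → Fin N → Ω → ℂ) (ω : Ω) :
    Fin d × Fin N → Fin d × Fin N → ℂ := fun x y => a x.1 y.1 x.2 y.2 ω

theorem IsGaussianBlockFamily.hasGaussianLaw_blockArray {Ω : Type*} [MeasurableSpace Ω]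
    {P : Measure Ω} {a : Fin d → Fin d → Fin N → Fin N → Ω → ℂ}
    (ha : IsGaussianBlockFamily P σ a) : HasGaussianLaw (blockArray a) P :=
  ha.gaussian.map (ContinuousLinearMap.pi fun x : Fin d × Fin N =>
    ContinuousLinearMap.pi fun y : Fin d × Fin N =>
      ContinuousLinearMap.proj (R := ℝ) (φ := fun _ : Fin d × Fin d × Fin N × Fin N => ℂ)
        (x.1, y.1, x.2, y.2))

/-- The law of the entries carries all the hypotheses, so the probability space can be forgotten. -/
theorem IsGaussianBlockFamily.isGaussianBlockLaw {Ω : Type*} [MeasurableSpace Ω]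
    {P : Measure Ω} {a : Fin d → Fin d → Fin N → Fin N → Ω → ℂ}
    (ha : IsGaussianBlockFamily P σ a) : IsGaussianBlockLaw σ (P.map (blockArray a)) := by
  have hG := ha.hasGaussianLaw_blockArray
  have hm : AEMeasurable (blockArray a) P := hG.aemeasurable
  have hint : Integrable (blockArray a) P := hG.integrable
  refine ⟨hG.isGaussian_map, ?_, ?_, ?_⟩
  · rw [integral_map hm (by fun_prop)]
    funext x y
    have hx : ∀ x, Integrable (fun ω => blockArray a ω x) P := fun x => hint.eval x
    rw [eval_integral hx, eval_integral fun y => (hx x).eval y]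
    exact ha.mean_zero _ _ _ _
  · refine (ae_map_iff hm (measurableSet_isHermitian (X := fun x => Matrix.of x)
      fun i j => by simp only [Matrix.of_apply]; fun_prop)).2 ?_
    filter_upwards [ha.selfadjoint] with ω hω
    ext x y
    exact (hω x.1 y.1 x.2 y.2).symm
  · intro u v w t
    rw [integral_map hm (by fun_prop)]
    exact ha.covariance _ _ _ _ _ _ _ _

theorem averagedEigenvalueDistribution_blockMatrix {Ω : Type*} [MeasurableSpace Ω]
    {P : Measure Ω} {a : Fin d → Fin d → Fin N → Fin N → Ω → ℂ}
    (hm : AEMeasurable (blockArray a) P) :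
    averagedEigenvalueDistribution P
      (fun ω => blockMatrix fun i j => Matrix.of fun r p => a i j r p ω)
      = averagedEigenvalueDistribution (P.map (blockArray a)) fun x => Matrix.of x := by
  have h : Measurable fun x : Fin d × Fin N → Fin d × Fin N → ℂ =>
      eigenvalueDistribution (Matrix.of x) :=
    measurable_eigenvalueDistribution fun i j => by simp only [Matrix.of_apply]; fun_prop
  rw [averagedEigenvalueDistribution, averagedEigenvalueDistribution, Measure.bind, Measure.bind,
    AEMeasurable.map_map_of_aemeasurable h.aemeasurable hm]
  rfl

/-- A bound for the values of `σ`. -/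
noncomputable def covBound (σ : Fin d → Fin d → Fin d → Fin d → ℂ) : ℝ :=
  ∑ i, ∑ k, ∑ l, ∑ j, ‖σ i k l j‖

theorem covBound_nonneg (σ : Fin d → Fin d → Fin d → Fin d → ℂ) : 0 ≤ covBound σ := by
  unfold covBound; positivity

theorem norm_le_covBound (σ : Fin d → Fin d → Fin d → Fin d → ℂ) (i k l j : Fin d) :
    ‖σ i k l j‖ ≤ covBound σ := by
  calc ‖σ i k l j‖ ≤ ∑ j, ‖σ i k l j‖ :=
        Finset.single_le_sum (f := fun j => ‖σ i k l j‖) (fun _ _ => by positivity)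
          (Finset.mem_univ _)
    _ ≤ ∑ l, ∑ j, ‖σ i k l j‖ :=
        Finset.single_le_sum (f := fun l => ∑ j, ‖σ i k l j‖) (fun _ _ => by positivity)
          (Finset.mem_univ _)
    _ ≤ ∑ k, ∑ l, ∑ j, ‖σ i k l j‖ :=
        Finset.single_le_sum (f := fun k => ∑ l, ∑ j, ‖σ i k l j‖) (fun _ _ => by positivity)
          (Finset.mem_univ _)
    _ ≤ _ :=
        Finset.single_le_sum (f := fun i => ∑ k, ∑ l, ∑ j, ‖σ i k l j‖) (fun _ _ => by positivity)
          (Finset.mem_univ _)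

/-- The Schur test for a symmetric kernel. -/
theorem norm_sum_mul_conj_le {κ : Type*} [Fintype κ] {c : κ → κ → ℂ} {w : κ → κ → ℝ} {C : ℝ}
    (hc : ∀ p q, ‖c p q‖ ≤ w p q) (hw : ∀ p q, w p q = w q p) (hC : ∀ p, ∑ q, w p q ≤ C)
    (b : κ → ℂ) : ‖∑ p, ∑ q, c p q * (b p * conj (b q))‖ ≤ C * ∑ p, ‖b p‖ ^ 2 := by
  have hw0 : ∀ p q, 0 ≤ w p q := fun p q => (norm_nonneg _).trans (hc p q)
  have h1 : ∑ p, ∑ q, w p q * ‖b p‖ ^ 2 ≤ C * ∑ p, ‖b p‖ ^ 2 := by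
    rw [Finset.mul_sum]
    refine Finset.sum_le_sum fun p _ => ?_
    rw [← Finset.sum_mul]
    exact mul_le_mul_of_nonneg_right (hC p) (by positivity)
  have h2 : ∑ p, ∑ q, w p q * ‖b q‖ ^ 2 = ∑ p, ∑ q, w p q * ‖b p‖ ^ 2 := by
    rw [Finset.sum_comm]
    simp only [hw]
  calc ‖∑ p, ∑ q, c p q * (b p * conj (b q))‖
      ≤ ∑ p, ∑ q, (w p q * ‖b p‖ ^ 2 + w p q * ‖b q‖ ^ 2) / 2 := by
        refine (norm_sum_le _ _).trans (Finset.sum_le_sum fun p _ => ?_)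
        refine (norm_sum_le _ _).trans (Finset.sum_le_sum fun q _ => ?_)
        rw [norm_mul, norm_mul, RCLike.norm_conj]
        have h3 : ‖b p‖ * ‖b q‖ ≤ (‖b p‖ ^ 2 + ‖b q‖ ^ 2) / 2 := by
          nlinarith [sq_nonneg (‖b p‖ - ‖b q‖)]
        calc _ ≤ w p q * ((‖b p‖ ^ 2 + ‖b q‖ ^ 2) / 2) :=
              mul_le_mul (hc p q) h3 (by positivity) (hw0 p q)
          _ = _ := by ring
    _ = ∑ p, ∑ q, w p q * ‖b p‖ ^ 2 := by
        simp only [← Finset.sum_div, Finset.sum_add_distrib, h2]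
        ring
    _ ≤ _ := h1

variable {γ : Measure (Fin d × Fin N → Fin d × Fin N → ℂ)}

/-- The covariance of the entries of a Gaussian block matrix, as a quadratic form, is of order
`1 / N`: each entry is correlated with `d ^ 2` others only. -/
theorem IsGaussianBlockLaw.integral_norm_trace_mul_sq_le (hγ : IsGaussianBlockLaw σ γ)
    (B : Matrix (Fin d × Fin N) (Fin d × Fin N) ℂ) :
    ∫ y, ‖(Matrix.of y * B).trace‖ ^ 2 ∂γ
      ≤ (covBound σ / ((d * N : ℕ) : ℝ) * d ^ 2) * ∑ i, ∑ j, ‖B i j‖ ^ 2 := by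
  have := hγ.isGaussian
  set κ := (Fin d × Fin N) × (Fin d × Fin N)
  have htr : ∀ y : Fin d × Fin N → Fin d × Fin N → ℂ,
      (Matrix.of y * B).trace = ∑ p : κ, y p.1 p.2 * B p.2 p.1 := by
    intro y
    rw [Fintype.sum_prod_type]
    simp [Matrix.trace, Matrix.mul_apply]
  have hsq : ∀ᵐ y ∂γ, ((‖(Matrix.of y * B).trace‖ ^ 2 : ℝ) : ℂ)
      = ∑ p : κ, ∑ q : κ, (B p.2 p.1 * conj (B q.2 q.1)) * (y p.1 p.2 * y q.2 q.1) := by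
    filter_upwards [hγ.isHermitian] with y hy
    have hy' : ∀ u v, conj (y u v) = y v u := fun u v => hy.apply v u
    push_cast
    rw [← Complex.mul_conj', htr, map_sum, Finset.sum_mul_sum]
    refine Finset.sum_congr rfl fun p _ => Finset.sum_congr rfl fun q _ => ?_
    rw [map_mul, hy']
    ring
  have hint : ∀ p q : κ, Integrable (fun y : Fin d × Fin N → Fin d × Fin N → ℂ =>
      (B p.2 p.1 * conj (B q.2 q.1)) * (y p.1 p.2 * y q.2 q.1)) γ := fun p q =>
    ((memLp_two_entry p.1 p.2).integrable_mul (memLp_two_entry q.2 q.1)).const_mul _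
  have hE : ((∫ y, ‖(Matrix.of y * B).trace‖ ^ 2 ∂γ : ℝ) : ℂ) = ∑ p : κ, ∑ q : κ,
      (∫ y, y p.1 p.2 * y q.2 q.1 ∂γ) * (B p.2 p.1 * conj (B q.2 q.1)) := by
    rw [← integral_complex_ofReal, integral_congr_ae hsq,
      integral_finsetSum _ fun p _ => integrable_finsetSum _ fun q _ => hint p q]
    refine Finset.sum_congr rfl fun p _ => ?_
    rw [integral_finsetSum _ fun q _ => hint p q]
    refine Finset.sum_congr rfl fun q _ => ?_
    rw [integral_const_mul, mul_comm]
  have hS := norm_sum_mul_conj_le (κ := κ) (c := fun p q => ∫ y, y p.1 p.2 * y q.2 q.1 ∂γ)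
    (w := fun p q => if p.1.2 = q.1.2 ∧ p.2.2 = q.2.2 then covBound σ / ((d * N : ℕ) : ℝ) else 0)
    (C := covBound σ / ((d * N : ℕ) : ℝ) * d ^ 2) ?_ ?_ ?_ (fun p => B p.2 p.1)
  · rw [← hE, Complex.norm_real, Real.norm_of_nonneg (by positivity), Fintype.sum_prod_type,
      Finset.sum_comm] at hS
    exact hS
  · intro p q
    simp only [hγ.covariance]
    split_ifs
    · rw [norm_div, Complex.norm_natCast]
      gcongr
      exact norm_le_covBound _ _ _ _ _
    · simp
  · intro p q
    simp only [eq_comm]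
  · intro p
    change ∑ q : (Fin d × Fin N) × (Fin d × Fin N), _ ≤ _
    rw [Fintype.sum_prod_type]
    refine le_of_eq ?_
    simp only [Fintype.sum_prod_type, ite_and]
    simp [Finset.sum_ite_irrel]
    ring

/-- The partial trace `id ⊗ tr_N`, which averages the diagonal of each block. -/
noncomputable def blockTrace (M : Matrix (Fin d × Fin N) (Fin d × Fin N) ℂ) :
    Matrix (Fin d) (Fin d) ℂ :=
  Matrix.of fun i j => (N : ℂ)⁻¹ * ∑ r, M (i, r) (j, r)

/-- The matrix `T` for which `tr (T M)` is the `(i, j)` entry of the partial trace of `M`. -/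
noncomputable def blockTraceDual (N : ℕ) (i j : Fin d) :
    Matrix (Fin d × Fin N) (Fin d × Fin N) ℂ :=
  Matrix.of fun b a => if b.1 = j ∧ a.1 = i ∧ b.2 = a.2 then (N : ℂ)⁻¹ else 0

theorem trace_blockTraceDual_mul (M : Matrix (Fin d × Fin N) (Fin d × Fin N) ℂ) (i j : Fin d) :
    (blockTraceDual N i j * M).trace = blockTrace M i j := by
  simp only [Matrix.trace, Matrix.diag_apply, Matrix.mul_apply, blockTraceDual, blockTrace,
    Matrix.of_apply, Fintype.sum_prod_type, ite_and, ite_mul, zero_mul, Finset.mul_sum]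
  simp [Finset.sum_ite_irrel]

theorem sum_norm_blockTraceDual_sq (hN : 0 < N) (i j : Fin d) :
    ∑ b, ∑ a, ‖blockTraceDual N i j b a‖ ^ 2 = 1 / (N : ℝ) := by
  have h : (N : ℝ) ≠ 0 := by positivity
  simp only [blockTraceDual, Matrix.of_apply, Fintype.sum_prod_type, ite_and]
  simp [apply_ite, Finset.sum_ite_irrel]
  field_simp

theorem normTrace_blockTrace (M : Matrix (Fin d × Fin N) (Fin d × Fin N) ℂ) :
    normTrace (blockTrace M) = ((Fintype.card (Fin d × Fin N) : ℝ)⁻¹ : ℝ) • M.trace := by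
  simp only [normTrace, blockTrace, Matrix.trace, Matrix.diag_apply, Matrix.of_apply,
    Fintype.sum_prod_type, Fintype.card_prod, Fintype.card_fin, ← Finset.mul_sum, Complex.real_smul]
  push_cast
  rw [mul_inv]
  ring

end BlockLaw

/-! ### The Schwinger-Dyson equation for block matrices -/

section MeanResolvent

open scoped Matrix.Norms.L2Operator

variable {ι : Type*} [Fintype ι] [DecidableEq ι]

/-- The expected resolvent of a random matrix with law `γ`. -/
noncomputable def meanResolvent (γ : Measure (ι → ι → ℂ)) (z : ℂ) : Matrix ι ι ℂ :=
  Matrix.of fun a b => ∫ x, resolventMatrix z (Matrix.of x) a b ∂γ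

/-- The derivative in `z` of the expected resolvent, which is the expectation of `-R(z)²`. -/
noncomputable def meanResolventDeriv (γ : Measure (ι → ι → ℂ)) (z : ℂ) : Matrix ι ι ℂ :=
  Matrix.of fun a b =>
    ∫ x, (-(resolventMatrix z (Matrix.of x) * resolventMatrix z (Matrix.of x))) a b ∂γ

variable {γ : Measure (ι → ι → ℂ)} [IsProbabilityMeasure γ]

theorem norm_meanResolvent_entry_le (hH : ∀ᵐ x ∂γ, (Matrix.of x).IsHermitian) {z : ℂ}
    (hz : z ∈ upperHalf) (a b : ι) : ‖meanResolvent γ z a b‖ ≤ 1 / z.im := by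
  simpa [meanResolvent] using
    norm_integral_le_of_norm_le_const (ae_norm_resolventMatrix_entry_le hH hz a b)

theorem norm_mul_resolventMatrix_self_le {X : Matrix ι ι ℂ} (hX : X.IsHermitian) {z : ℂ}
    (hz : z ∈ upperHalf) : ‖resolventMatrix z X * resolventMatrix z X‖ ≤ 1 / z.im ^ 2 := by
  have hz' : 0 < z.im := hz
  have h := norm_resolventMatrix_le hX hz
  calc _ ≤ (1 / z.im) * (1 / z.im) := (norm_mul_le _ _).trans (by gcongr)
    _ = _ := by rw [← sq, one_div_pow]

theorem norm_meanResolventDeriv_entry_le (hH : ∀ᵐ x ∂γ, (Matrix.of x).IsHermitian) {z : ℂ}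
    (hz : z ∈ upperHalf) (a b : ι) : ‖meanResolventDeriv γ z a b‖ ≤ 1 / z.im ^ 2 := by
  have h : ∀ᵐ x ∂γ, ‖(-(resolventMatrix z (Matrix.of x) * resolventMatrix z (Matrix.of x))) a b‖
      ≤ 1 / z.im ^ 2 := by
    filter_upwards [hH] with x hx
    rw [Matrix.neg_apply, norm_neg]
    exact (norm_entry_le_l2_opNorm _ _ _).trans (norm_mul_resolventMatrix_self_le hx hz)
  simpa [meanResolventDeriv] using norm_integral_le_of_norm_le_const h

theorem norm_meanResolvent_taylor_le (hH : ∀ᵐ x ∂γ, (Matrix.of x).IsHermitian) {z w : ℂ}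
    (hz : z ∈ upperHalf) (hw : w ∈ upperHalf) (a b : ι) :
    ‖meanResolvent γ w a b - meanResolvent γ z a b - (w - z) * meanResolventDeriv γ z a b‖
      ≤ ‖w - z‖ ^ 2 / (w.im * z.im ^ 2) := by
  have hz' : 0 < z.im := hz
  have hw' : 0 < w.im := hw
  have hm : Measurable fun x : ι → ι → ℂ =>
      (-(resolventMatrix z (Matrix.of x) * resolventMatrix z (Matrix.of x))) a b := by
    have := measurable_resolventMatrix_of_entry (ι := ι) z
    simp only [Matrix.neg_apply, Matrix.mul_apply]
    fun_prop
  have hint : Integrable (fun x : ι → ι → ℂ =>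
      (-(resolventMatrix z (Matrix.of x) * resolventMatrix z (Matrix.of x))) a b) γ := by
    refine Integrable.of_bound hm.aestronglyMeasurable (1 / z.im ^ 2) ?_
    filter_upwards [hH] with x hx
    rw [Matrix.neg_apply, norm_neg]
    exact (norm_entry_le_l2_opNorm _ _ _).trans (norm_mul_resolventMatrix_self_le hx hz)
  simp only [meanResolvent, meanResolventDeriv, Matrix.of_apply]
  have hsub : Integrable (fun x : ι → ι → ℂ =>
      resolventMatrix w (Matrix.of x) a b - resolventMatrix z (Matrix.of x) a b) γ :=
    (integrable_resolventMatrix_entry hH hw a b).sub (integrable_resolventMatrix_entry hH hz a b)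
  rw [← integral_const_mul, ← integral_sub (integrable_resolventMatrix_entry hH hw a b)
    (integrable_resolventMatrix_entry hH hz a b), ← integral_sub hsub (hint.const_mul _)]
  have h : ∀ᵐ x ∂γ, ‖resolventMatrix w (Matrix.of x) a b - resolventMatrix z (Matrix.of x) a b
      - (w - z) * (-(resolventMatrix z (Matrix.of x) * resolventMatrix z (Matrix.of x))) a b‖
      ≤ ‖w - z‖ ^ 2 / (w.im * z.im ^ 2) := by
    filter_upwards [hH] with x hx
    have h1 := congrFun (congrFun (resolventMatrix_taylor hx hz hw) a) b
    simp only [Matrix.sub_apply, Matrix.smul_apply, smul_eq_mul] at h1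
    rw [h1, norm_mul, norm_pow]
    calc _ ≤ ‖w - z‖ ^ 2 * ((1 / w.im) * (1 / z.im ^ 2)) := by
          gcongr
          refine (norm_entry_le_l2_opNorm _ _ _).trans ((norm_mul_le _ _).trans ?_)
          have h2 := norm_resolventMatrix_le hx hw
          have h3 := norm_mul_resolventMatrix_self_le hx hz
          gcongr
      _ = _ := by field_simp
  simpa using norm_integral_le_of_norm_le_const h

end MeanResolvent

section BlockTrace

variable {d N : ℕ} {σ : Fin d → Fin d → Fin d → Fin d → ℂ}

theorem norm_blockTrace_entry_le {M : Matrix (Fin d × Fin N) (Fin d × Fin N) ℂ} {c : ℝ}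
    (hc : 0 ≤ c) (hM : ∀ a b, ‖M a b‖ ≤ c) (i j : Fin d) : ‖blockTrace M i j‖ ≤ c := by
  rw [blockTrace, Matrix.of_apply, norm_mul, norm_inv, Complex.norm_natCast]
  rcases N.eq_zero_or_pos with rfl | hN
  · simpa using hc
  · have hN' : (0 : ℝ) < N := by exact_mod_cast hN
    rw [inv_mul_le_iff₀ hN']
    refine (norm_sum_le _ _).trans ((Finset.sum_le_sum fun r _ => hM (i, r) (j, r)).trans_eq ?_)
    simp

theorem sum_comm_five {α β : Type*} [Fintype α] [Fintype β] (F : α → β → α → β → β → ℂ) :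
    ∑ r, ∑ k, ∑ p, ∑ l, ∑ m, F r k p l m = ∑ k, ∑ l, ∑ m, ∑ p, ∑ r, F r k p l m := by
  rw [Finset.sum_comm]
  refine Finset.sum_congr rfl fun k _ => ?_
  calc ∑ r, ∑ p, ∑ l, ∑ m, F r k p l m
      = ∑ r, ∑ l, ∑ p, ∑ m, F r k p l m := Finset.sum_congr rfl fun _ _ => Finset.sum_comm
    _ = ∑ l, ∑ r, ∑ p, ∑ m, F r k p l m := Finset.sum_comm
    _ = ∑ l, ∑ r, ∑ m, ∑ p, F r k p l m :=
        Finset.sum_congr rfl fun _ _ => Finset.sum_congr rfl fun _ _ => Finset.sum_comm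
    _ = ∑ l, ∑ m, ∑ r, ∑ p, F r k p l m := Finset.sum_congr rfl fun _ _ => Finset.sum_comm
    _ = ∑ l, ∑ m, ∑ p, ∑ r, F r k p l m :=
        Finset.sum_congr rfl fun _ _ => Finset.sum_congr rfl fun _ _ => Finset.sum_comm

variable {γ : Measure (Fin d × Fin N → Fin d × Fin N → ℂ)}

/-- The Schwinger-Dyson equation for the partial trace of the resolvent. -/
theorem IsGaussianBlockLaw.mul_blockTrace_meanResolvent (hγ : IsGaussianBlockLaw σ γ) (hN : 0 < N)
    {z : ℂ} (hz : z ∈ upperHalf) (i j : Fin d) :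
    z * blockTrace (meanResolvent γ z) i j = (1 : Matrix (Fin d) (Fin d) ℂ) i j +
      (1 / (d : ℂ)) * ∑ k, ∑ l, ∑ m, σ i k l m *
        ∫ x, blockTrace (resolventMatrix z (Matrix.of x)) k l *
          blockTrace (resolventMatrix z (Matrix.of x)) m j ∂γ := by
  have := hγ.isGaussian
  have hN' : (N : ℂ) ≠ 0 := by exact_mod_cast hN.ne'
  set R := fun x : Fin d × Fin N → Fin d × Fin N → ℂ => resolventMatrix z (Matrix.of x) with hR
  have hint : ∀ a b c e, Integrable (fun x => R x a b * R x c e) γ := fun a b c e =>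
    (integrable_resolventMatrix_entry hγ.isHermitian hz a b).mul_bdd
      (measurable_resolventMatrix_of_entry z c e).aestronglyMeasurable
      (ae_norm_resolventMatrix_entry_le hγ.isHermitian hz c e)
  have hprod : ∀ k l m, ∫ x, blockTrace (R x) k l * blockTrace (R x) m j ∂γ
      = (N : ℂ)⁻¹ * ((N : ℂ)⁻¹ * ∑ p, ∑ r, ∫ x, R x (k, p) (l, p) * R x (m, r) (j, r) ∂γ) := by
    intro k l m
    have h : ∀ x, blockTrace (R x) k l * blockTrace (R x) m j
        = (N : ℂ)⁻¹ * ((N : ℂ)⁻¹ * ∑ p, ∑ r, R x (k, p) (l, p) * R x (m, r) (j, r)) := by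
      intro x
      rw [blockTrace, Matrix.of_apply, Matrix.of_apply, ← Finset.sum_mul_sum]
      ring
    simp only [h]
    rw [integral_const_mul, integral_const_mul,
      integral_finsetSum _ fun p _ => integrable_finsetSum _ fun r _ => hint _ _ _ _]
    congr 2
    exact Finset.sum_congr rfl fun p _ => integral_finsetSum _ fun r _ => hint _ _ _ _
  have hentry : ∀ r, z * meanResolvent γ z (i, r) (j, r) = (1 : Matrix (Fin d) (Fin d) ℂ) i j +
      ∑ k, ∑ p, ∑ l, ∑ m, σ i k l m / ((d * N : ℕ) : ℂ) *
        ∫ x, R x (k, p) (l, p) * R x (m, r) (j, r) ∂γ := by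
    intro r
    rw [meanResolvent, Matrix.of_apply,
      integral_resolventMatrix_entry_eq hγ.integral_id hγ.isHermitian hz]
    congr 1
    · simp [Matrix.one_apply]
    · simp only [hγ.covariance, Fintype.sum_prod_type, ite_and, ite_mul, zero_mul]
      simp [Finset.sum_ite_irrel, hR]
  simp only [hR] at hprod
  simp only [hprod]
  calc z * blockTrace (meanResolvent γ z) i j
      = (N : ℂ)⁻¹ * ∑ r, z * meanResolvent γ z (i, r) (j, r) := by
        rw [blockTrace, Matrix.of_apply, ← Finset.mul_sum]; ring
    _ = (1 : Matrix (Fin d) (Fin d) ℂ) i j + (N : ℂ)⁻¹ * ∑ r, ∑ k, ∑ p, ∑ l, ∑ m,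
        σ i k l m / ((d * N : ℕ) : ℂ) * ∫ x, R x (k, p) (l, p) * R x (m, r) (j, r) ∂γ := by
        simp only [hentry, Finset.sum_add_distrib, Finset.sum_const, Finset.card_univ,
          Fintype.card_fin, nsmul_eq_mul]
        rw [mul_add, inv_mul_cancel_left₀ hN']
    _ = _ := by
        rw [sum_comm_five]
        congr 1
        simp only [Finset.mul_sum, hR]
        refine Finset.sum_congr rfl fun k _ => Finset.sum_congr rfl fun l _ =>
          Finset.sum_congr rfl fun m _ => Finset.sum_congr rfl fun p _ =>
          Finset.sum_congr rfl fun r _ => ?_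
        push_cast
        rw [div_eq_mul_inv, mul_inv]
        ring

theorem covMap_mul_apply (D D' : Matrix (Fin d) (Fin d) ℂ) (i j : Fin d) :
    (covMap σ D * D') i j = (1 / (d : ℂ)) * ∑ k, ∑ l, ∑ m, σ i k l m * (D k l * D' m j) := by
  simp only [covMap, Matrix.mul_apply, Matrix.of_apply, Finset.mul_sum, Finset.sum_mul]
  rw [Finset.sum_comm]
  refine Finset.sum_congr rfl fun k _ => ?_
  rw [Finset.sum_comm]
  refine Finset.sum_congr rfl fun l _ => Finset.sum_congr rfl fun m _ => by ring

/-- The entries of the partial trace of the resolvent are asymptotically uncorrelated. -/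
theorem IsGaussianBlockLaw.norm_covariance_blockTrace_le (hγ : IsGaussianBlockLaw σ γ) (hN : 0 < N)
    {z : ℂ} (hz : z ∈ upperHalf) (i j k l : Fin d) :
    ‖∫ x, blockTrace (resolventMatrix z (Matrix.of x)) i j *
          blockTrace (resolventMatrix z (Matrix.of x)) k l ∂γ
        - blockTrace (meanResolvent γ z) i j * blockTrace (meanResolvent γ z) k l‖
      ≤ (Real.pi / 2) ^ 2 *
        ((covBound σ / ((d * N : ℕ) : ℝ) * d ^ 2) * ((1 / z.im) ^ 4 * (1 / (N : ℝ)))) / 2 := by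
  have := hγ.isGaussian
  have hK0 : 0 ≤ covBound σ / ((d * N : ℕ) : ℝ) * d ^ 2 := by
    have := covBound_nonneg σ; positivity
  have hmean : ∀ i j, blockTrace (meanResolvent γ z) i j
      = ∫ x, blockTrace (resolventMatrix z (Matrix.of x)) i j ∂γ := by
    intro i j
    simp only [blockTrace, meanResolvent, Matrix.of_apply]
    rw [integral_const_mul, integral_finsetSum _ fun r _ =>
      integrable_resolventMatrix_entry hγ.isHermitian hz _ _]
  have hLp : ∀ i j, MemLp (fun x => blockTrace (resolventMatrix z (Matrix.of x)) i j) 2 γ := by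
    intro i j
    simp only [← trace_blockTraceDual_mul]
    exact MemLp.of_bound (measurable_trace_mul_resolventMatrix _ z).aestronglyMeasurable _
      (ae_norm_trace_mul_resolventMatrix_le hγ.isHermitian _ hz)
  have hvar := fun i j => integral_norm_trace_sub_sq_le hγ.integral_id hγ.isHermitian hK0
    hγ.integral_norm_trace_mul_sq_le (blockTraceDual N i j) hz
  simp only [trace_blockTraceDual_mul, sum_norm_blockTraceDual_sq hN] at hvar
  rw [hmean, hmean]
  refine (norm_integral_mul_sub_mul_le (hLp i j) (hLp k l)).trans ?_
  linarith [hvar i j, hvar k l]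

/-- The partial trace of the expected resolvent solves the equation for the operator-valued Cauchy
transform up to an error of order `1 / N²`. -/
theorem IsGaussianBlockLaw.norm_equation_error_le (hγ : IsGaussianBlockLaw σ γ) (hN : 0 < N)
    {z : ℂ} (hz : z ∈ upperHalf) (i j : Fin d) :
    ‖(z • blockTrace (meanResolvent γ z) - 1
        - covMap σ (blockTrace (meanResolvent γ z)) * blockTrace (meanResolvent γ z)) i j‖
      ≤ covBound σ * ((Real.pi / 2) ^ 2 *
        ((covBound σ / ((d * N : ℕ) : ℝ) * d ^ 2) * ((1 / z.im) ^ 4 * (1 / (N : ℝ)))) / 2) := by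
  rw [Matrix.sub_apply, Matrix.sub_apply, Matrix.smul_apply, smul_eq_mul,
    hγ.mul_blockTrace_meanResolvent hN hz, covMap_mul_apply, add_sub_cancel_left, ← mul_sub]
  simp only [← Finset.sum_sub_distrib, ← mul_sub]
  set v := (Real.pi / 2) ^ 2 *
        ((covBound σ / ((d * N : ℕ) : ℝ) * d ^ 2) * ((1 / z.im) ^ 4 * (1 / (N : ℝ)))) / 2 with hv
  have hv0 : 0 ≤ v := (norm_nonneg _).trans (hγ.norm_covariance_blockTrace_le hN hz i i i i)
  have hd : 1 ≤ d := i.pos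
  have hd' : ‖(1 / (d : ℂ))‖ ≤ 1 := by
    rw [norm_div, norm_one, Complex.norm_natCast]
    exact div_le_one_of_le₀ (by exact_mod_cast hd) (by positivity)
  calc _ ≤ 1 * ∑ k, ∑ l, ∑ m, ‖σ i k l m‖ * v := by
        rw [norm_mul]
        refine mul_le_mul hd' ?_ (norm_nonneg _) zero_le_one
        refine (norm_sum_le _ _).trans (Finset.sum_le_sum fun k _ => ?_)
        refine (norm_sum_le _ _).trans (Finset.sum_le_sum fun l _ => ?_)
        refine (norm_sum_le _ _).trans (Finset.sum_le_sum fun m _ => ?_)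
        rw [norm_mul]
        gcongr
        exact hγ.norm_covariance_blockTrace_le hN hz k l m j
    _ = (∑ k, ∑ l, ∑ m, ‖σ i k l m‖) * v := by simp only [one_mul, Finset.sum_mul]
    _ ≤ covBound σ * v := by
        gcongr
        exact Finset.single_le_sum (f := fun i => ∑ k, ∑ l, ∑ m, ‖σ i k l m‖)
          (fun _ _ => by positivity) (Finset.mem_univ _)

end BlockTrace

/-! ### The limit -/

section Limit

open scoped Matrix.Norms.Elementwise

variable {d : ℕ} {σ : Fin d → Fin d → Fin d → Fin d → ℂ}

/-- The continuous bilinear map `(A, B) ↦ η(A) B`. -/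
noncomputable def covBilin (σ : Fin d → Fin d → Fin d → Fin d → ℂ) :
    Matrix (Fin d) (Fin d) ℂ →L[ℂ] Matrix (Fin d) (Fin d) ℂ →L[ℂ] Matrix (Fin d) (Fin d) ℂ :=
  (LinearMap.mk₂ ℂ (fun A B => covMap σ A * B)
    (fun A A' B => by
      rw [← add_mul]
      congr 1
      ext i j
      simp [covMap, mul_add, Finset.sum_add_distrib])
    (fun c A B => by
      rw [← smul_mul_assoc]
      congr 1
      ext i j
      simp only [covMap, Matrix.of_apply, Matrix.smul_apply, smul_eq_mul, Finset.mul_sum]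
      exact Finset.sum_congr rfl fun _ _ => Finset.sum_congr rfl fun _ _ => by ring)
    (fun A B B' => mul_add _ _ _)
    (fun c A B => mul_smul_comm _ _ _)).toContinuousBilinearMap

theorem analyticOnNhd_entry_iff_differentiableOn {G : ℂ → Matrix (Fin d) (Fin d) ℂ} :
    (∀ i j, AnalyticOnNhd ℂ (fun z => G z i j) upperHalf) ↔ DifferentiableOn ℂ G upperHalf := by
  have h : DifferentiableOn ℂ G upperHalf ↔
      ∀ i j, DifferentiableOn ℂ (fun z => G z i j) upperHalf := by
    refine (differentiableOn_pi (Φ := fun z => G z)).trans (forall_congr' fun i => ?_)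
    exact differentiableOn_pi
  rw [h]
  exact forall₂_congr fun i j => (Complex.analyticOnNhd_iff_differentiableOn isOpen_upperHalf)

theorem IsOperatorCauchySolution.eqOn {G G' : ℂ → Matrix (Fin d) (Fin d) ℂ}
    (hG : IsOperatorCauchySolution σ G) (hG' : IsOperatorCauchySolution σ G') :
    Set.EqOn G G' upperHalf :=
  eqOn_of_analytic_solutions (covBilin σ) 1
    (analyticOnNhd_entry_iff_differentiableOn.1 hG.analytic)
    (analyticOnNhd_entry_iff_differentiableOn.1 hG'.analytic) hG.tendsto hG'.tendsto
    hG.equation hG'.equation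

/-- The partial traces of the expected resolvents converge to a solution of the equation for the
operator-valued Cauchy transform. The sizes are shifted by one, since there is nothing to say about
matrices of size zero. -/
theorem exists_tendsto_blockTrace_meanResolvent
    {γ : ∀ N, Measure (Fin d × Fin (N + 1) → Fin d × Fin (N + 1) → ℂ)}
    (hγ : ∀ N, IsGaussianBlockLaw σ (γ N)) :
    ∃ G : ℂ → Matrix (Fin d) (Fin d) ℂ, IsOperatorCauchySolution σ G ∧
      ∀ z ∈ upperHalf, Tendsto (fun N => blockTrace (meanResolvent (γ N) z)) atTop (𝓝 (G z)) := by
  have hprob : ∀ N, IsProbabilityMeasure (γ N) := fun N => by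
    have := (hγ N).isGaussian
    infer_instance
  suffices h : ∃ G : ℂ → Matrix (Fin d) (Fin d) ℂ,
      (∀ z ∈ upperHalf, Tendsto (fun N => blockTrace (meanResolvent (γ N) z)) atTop (𝓝 (G z))) ∧
      DifferentiableOn ℂ G upperHalf ∧
      (∀ z ∈ upperHalf, z • G z = 1 + covBilin σ (G z) (G z)) ∧
      Tendsto (fun z => z • G z) (Bornology.cobounded ℂ ⊓ 𝓟 upperHalf) (𝓝 1) by
    obtain ⟨G, hlim, hdiff, heq, htend⟩ := h
    exact ⟨G, ⟨analyticOnNhd_entry_iff_differentiableOn.2 hdiff, htend, heq⟩, hlim⟩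
  refine exists_limit_solution (covBilin σ) 1 (K := 1)
    (G := fun N z => blockTrace (meanResolvent (γ N) z))
    (G' := fun N z => blockTrace (meanResolventDeriv (γ N) z)) ?_ ?_ ?_ ?_
  · intro N z hz
    have hz' : 0 < z.im := hz
    exact (Matrix.norm_le_iff (by positivity)).2 (norm_blockTrace_entry_le (by positivity)
      (norm_meanResolvent_entry_le (hγ N).isHermitian hz))
  · intro N z hz
    exact (Matrix.norm_le_iff (by positivity)).2 (norm_blockTrace_entry_le (by positivity)
      (norm_meanResolventDeriv_entry_le (hγ N).isHermitian hz))
  · intro N z hz w hw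
    have hz' : 0 < z.im := hz
    have hw' : 0 < w.im := hw
    have hlin : blockTrace (meanResolvent (γ N) w) - blockTrace (meanResolvent (γ N) z)
        - (w - z) • blockTrace (meanResolventDeriv (γ N) z)
        = blockTrace (meanResolvent (γ N) w - meanResolvent (γ N) z
          - (w - z) • meanResolventDeriv (γ N) z) := by
      ext i j
      simp only [blockTrace, Matrix.sub_apply, Matrix.smul_apply, Matrix.of_apply, smul_eq_mul,
        Finset.sum_sub_distrib, ← Finset.mul_sum]
      ring
    rw [hlin, one_mul]
    refine (Matrix.norm_le_iff (by positivity)).2 (norm_blockTrace_entry_le (by positivity) ?_)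
    exact norm_meanResolvent_taylor_le (hγ N).isHermitian hz hw
  · intro z hz
    have hz' : 0 < z.im := hz
    have hσ := covBound_nonneg σ
    have hb : ∀ N : ℕ, ‖z • blockTrace (meanResolvent (γ N) z) - 1
        - covBilin σ (blockTrace (meanResolvent (γ N) z)) (blockTrace (meanResolvent (γ N) z))‖
        ≤ covBound σ * ((Real.pi / 2) ^ 2 *
        ((covBound σ * d ^ 2) * ((1 / z.im) ^ 4 * (1 / ((N : ℝ) + 1)))) / 2) := by
      intro N
      refine (Matrix.norm_le_iff (by positivity)).2 fun i j => ?_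
      refine ((hγ N).norm_equation_error_le N.succ_pos hz i j).trans ?_
      have hdN : (1 : ℝ) ≤ ((d * (N + 1) : ℕ) : ℝ) := by
        exact_mod_cast Nat.mul_pos i.pos N.succ_pos
      push_cast at hdN ⊢
      gcongr
      exact div_le_self hσ hdN
    refine squeeze_zero_norm hb ?_
    have h := (tendsto_one_div_add_atTop_nhds_zero_nat (𝕜 := ℝ)).const_mul
      (covBound σ * (Real.pi / 2) ^ 2 * (covBound σ * d ^ 2) * (1 / z.im) ^ 4 / 2)
    rw [mul_zero] at h
    exact h.congr fun N => by ring

theorem continuous_normTrace : Continuous (normTrace : Matrix (Fin d) (Fin d) ℂ → ℂ) := by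
  unfold normTrace; fun_prop

/-- The normalized trace of a solution has the asymptotics of the Cauchy transform of a probability
measure. -/
theorem IsOperatorCauchySolution.tendsto_normTrace (hd : 0 < d)
    {G : ℂ → Matrix (Fin d) (Fin d) ℂ} (hG : IsOperatorCauchySolution σ G) :
    Tendsto (fun y : ℝ => (y * Complex.I) * normTrace (G (y * Complex.I))) atTop (𝓝 1) := by
  have hd' : (d : ℂ) ≠ 0 := by exact_mod_cast hd.ne'
  have hI : Tendsto (fun y : ℝ => (y * Complex.I : ℂ)) atTop
      (Bornology.cobounded ℂ ⊓ 𝓟 upperHalf) := by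
    refine tendsto_inf.2 ⟨?_, tendsto_principal.2 ?_⟩
    · rw [← tendsto_norm_atTop_iff_cobounded]
      simpa using tendsto_abs_atTop_atTop
    · filter_upwards [eventually_gt_atTop 0] with y hy
      simpa [upperHalf] using hy
  have h := (continuous_normTrace.tendsto _).comp (hG.tendsto.comp hI)
  have h1 : normTrace (1 : Matrix (Fin d) (Fin d) ℂ) = 1 := by simp [normTrace, hd']
  rw [h1] at h
  refine h.congr fun y => ?_
  simp only [Function.comp_def, normTrace, Matrix.trace_smul, smul_eq_mul]
  ring

theorem cauchyTransform_averagedEigenvalueDistribution_eq {N : ℕ} [Nonempty (Fin d × Fin N)]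
    {γ : Measure (Fin d × Fin N → Fin d × Fin N → ℂ)} (hγ : IsGaussianBlockLaw σ γ) {z : ℂ}
    (hz : z ∈ upperHalf) :
    cauchyTransform (averagedEigenvalueDistribution γ fun x => Matrix.of x) z
      = normTrace (blockTrace (meanResolvent γ z)) := by
  have := hγ.isGaussian
  rw [cauchyTransform_averagedEigenvalueDistribution
    (fun i j => by simp only [Matrix.of_apply]; fun_prop) hγ.isHermitian hz, normTrace_blockTrace,
    integral_smul]
  congr 1
  simp only [Matrix.trace, Matrix.diag_apply, meanResolvent, Matrix.of_apply]
  exact integral_finsetSum _ fun r _ => integrable_resolventMatrix_entry hγ.isHermitian hz _ _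

end Limit

end BlockMatrix

theorem theorem1 (d : ℕ) (hd : 0 < d) (σ : Fin d → Fin d → Fin d → Fin d → ℂ)
    {Ω : ℕ → Type*} [∀ N, MeasurableSpace (Ω N)]
    (P : ∀ N, Measure (Ω N)) [∀ N, IsProbabilityMeasure (P N)]
    (a : ∀ N, Fin d → Fin d → Fin N → Fin N → Ω N → ℂ)
    (ha : ∀ N, 0 < N → BlockMatrix.IsGaussianBlockFamily (P N) σ (a N)) :
    ∃ (μ : Measure ℝ) (G : ℂ → Matrix (Fin d) (Fin d) ℂ),
      IsProbabilityMeasure μ ∧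
      (∀ f : ℝ →ᵇ ℝ,
        Tendsto
          (fun N => ∫ x, f x ∂(BlockMatrix.averagedEigenvalueDistribution (P N)
            fun ω => BlockMatrix.blockMatrix fun i j => Matrix.of fun r p => a N i j r p ω))
          atTop (𝓝 (∫ x, f x ∂μ))) ∧
      (∀ z ∈ BlockMatrix.upperHalf,
        BlockMatrix.cauchyTransform μ z = BlockMatrix.normTrace (G z)) ∧
      BlockMatrix.IsOperatorCauchySolution σ G ∧
      (∀ G' : ℂ → Matrix (Fin d) (Fin d) ℂ, BlockMatrix.IsOperatorCauchySolution σ G' →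
        Set.EqOn G' G BlockMatrix.upperHalf) := by
  have haN : ∀ N : ℕ, BlockMatrix.IsGaussianBlockFamily (P (N + 1)) σ (a (N + 1)) := fun N =>
    ha (N + 1) N.succ_pos
  -- Nothing is assumed about `N = 0`, so the sequence is shifted by one.
  set γ := fun N : ℕ => (P (N + 1)).map (BlockMatrix.blockArray (a (N + 1))) with hγdef
  have hγ : ∀ N, BlockMatrix.IsGaussianBlockLaw σ (γ N) := fun N => (haN N).isGaussianBlockLaw
  have hprob : ∀ N, IsProbabilityMeasure (γ N) := fun N => by
    have := (hγ N).isGaussian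
    infer_instance
  have hne : ∀ N : ℕ, Nonempty (Fin d × Fin (N + 1)) := fun N => ⟨(⟨0, hd⟩, 0)⟩
  set ρ := fun N => BlockMatrix.averagedEigenvalueDistribution (γ N) fun x => Matrix.of x with hρ
  have hρprob : ∀ N, IsProbabilityMeasure (ρ N) := fun N =>
    BlockMatrix.isProbabilityMeasure_averagedEigenvalueDistribution
      (fun i j => by simp only [Matrix.of_apply]; fun_prop) (hγ N).isHermitian
  obtain ⟨G, hG, hlim⟩ := BlockMatrix.exists_tendsto_blockTrace_meanResolvent hγ
  obtain ⟨ν, hν, hνG⟩ := BlockMatrix.exists_tendsto_of_tendsto_cauchyTransform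
    (fun N => (⟨ρ N, hρprob N⟩ : ProbabilityMeasure ℝ)) (g := fun z => BlockMatrix.normTrace (G z))
    (fun z hz => ((BlockMatrix.continuous_normTrace.tendsto _).comp (hlim z hz)).congr fun N =>
      (BlockMatrix.cauchyTransform_averagedEigenvalueDistribution_eq (hγ N) hz).symm)
    (hG.tendsto_normTrace hd)
  refine ⟨ν, G, inferInstance, fun f => ?_, hνG, hG, fun G' hG' => hG'.eqOn hG⟩
  rw [← tendsto_add_atTop_iff_nat 1]
  refine ((ProbabilityMeasure.tendsto_iff_forall_integral_tendsto.1 hν) f).congr fun N => ?_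
  rw [BlockMatrix.averagedEigenvalueDistribution_blockMatrix
    (haN N).hasGaussianLaw_blockArray.aemeasurable]
  rfl
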